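/- **Setting.** Let $\mathbb F_q$ be a finite field. A model consists of $L=P\ell$ parameters in $\mathbb F_q$, grouped into $P$ subpackets of $\ell\ge 1$ parameters, and the subpackets are divided into $B$ consecutive segments of equal size $P/B$, where $1\le B<P$ and $B\mid P$. It is stored on $N$ non-colluding databases. In one round, a user first downloads $Pr'$ subpackets, chosen arbitrarily by the databases through permuted indices (reading phase), and then uploads updates of $Pr$ subpackets (writing phase); $Pr$ and $Pr'$ are integers. Let $X$ be the set of indices of the $Pr$ updated subpackets, $\hat X_i$ the number of them in segment $i$, and $(\tilde X_1,\dots,\tilde X_B)$ the tuple $(\hat X_1,\dots,\hat X_B)$ irrespective of order (a multiset). The model $W$, the set $X$ and the update values $\Delta$ have an arbitrary joint law and are independent of the scheme's random permutations and noise symbols, all of which are independent and uniform. Costs are counted in $q$-ary symbols (an element of a finite set $A$ counts as $\log_q|A|$): the reading (writing) cost is the total number of symbols downloaded (uploaded), including permuted indices, divided by $L$; the storage complexity is the order of the number of symbols stored in each database. **Schemes.** Let $\alpha_1,\dots,\alpha_N\in\mathbb F_q$ be distinct and, in the uncoded cases 1 and 3, let $f_1,\dots,f_\ell\in\mathbb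 F_q$ be distinct and different from all $\alpha_n$; in the coded cases 2 and 4 let all $\alpha_n$ be nonzero (such constants exist when $q$ is large enough). Write $\Gamma_n=\mathrm{diag}\big(\frac1{f_1-\alpha_n},\dots,\frac1{f_\ell-\alpha_n}\big)$, and let $Z$ (with indices) denote uniform noise that is the same for all databases. Database $n$ stores * for each subpacket $s$: the $\ell$ symbols $\frac{W_k^{[s]}}{f_k-\alpha_n}+\sum_{j=0}^{d}\alpha_n^jZ_{k,j}^{[s]}$ in the uncoded cases ($d=\ell$ in case 1, $d=\ell+1$ in case 3), or the single symbol $\sum_{k=1}^\ell\frac{W_k^{[s]}}{\alpha_n^k}+\sum_{j=0}^{d}\alpha_n^jZ_j^{[s]}$ in the coded cases ($d=\ell$ in case 2, $d=2\ell$ in case 4); * for each segment $i$, with a uniformly random permutation of its $P/B$ subpackets and its permutation reversing matrix $R^{[i]}$: the matrix $R_n^{[i]}=R^{[i]}\otimes\Gamma_n+Z^{[i]}$ (uncoded) or $R_n^{[i]}=R^{[i]}+\alpha_n^\ell Z^{[i]}$ (coded); * in cases 3 and 4, for a uniformly random permutation of the segments with reversing matrix $\hat R$: the matrix $\hat R_n=\hat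 R\otimes I_\ell+(I_B\otimes\Gamma_n^{-1})\hat Z$ (case 3) or $\hat R_n=\hat R+\alpha_n^\ell\hat Z$ (case 4). The users know the permutations. For each requested permuted index, database $n$ answers with one symbol: the inner product of its stored data with the column (coded cases) or the sum of the $\ell$ columns, rescaled by $\Gamma_n^{-1}$ (uncoded cases), of its reversing matrix at that index; in cases 3 and 4 this is the block diagonal matrix of the $R_n^{[i]}$ times the block matrix with blocks $I_{P/B}\otimes(\hat R_n)_{i,j}$ (case 3) or times $\hat R_n\otimes I_{P/B}$ (case 4). For each updated subpacket the user sends to database $n$ its permuted index and the symbol $\sum_{k}\prod_{j\ne k}\frac{f_j-\alpha_n}{f_j-f_k}\Delta_k+\prod_j(f_j-\alpha_n)Z$ (uncoded) or $\sum_k\frac{\Delta_k}{\alpha_n^k}+Z$ (coded), with fresh uniform $Z$; the $Pr$ tuples are listed in the order of the permuted indices. Each database places the symbols in a vector at their permuted indices (repeating each $\ell$ times in the uncoded cases), multiplies it by its reversing matrix and adds the result to its stored data. The subpacketization is given by $N=2\ell+2$, $N=3\ell+1$, $N=2\ell+4$, $N=5\ell+1$ in cases 1, 2, 3, 4. **Theorem.**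 The four schemes have the following costs, where the constants in $O(\cdot)$ are absolute, and leakages. | case | storage, permutations | reading cost | writing cost | storage complexity | leakage on $X$ | |---|---|---|---|---|---| | 1 | uncoded, within segments | $\frac{2r'(1+\frac{\log_q P}{N})}{1-\frac2N}$ | $\frac{2r(1+\log_q P)}{1-\frac2N}$ | $O(\frac{L^2}{B})$ | $H(\hat X_1,\dots,\hat X_B)$ | | 2 | MDS coded, within segments | $\frac{3r'(1+\frac{\log_q P}{N})}{1-\frac1N}$ | $\frac{3r(1+\log_q P)}{1-\frac1N}$ | $O(\frac{L^2}{BN^2})$ | $H(\hat X_1,\dots,\hat X_B)$ | | 3 | uncoded, within and inter-segment | $\frac{2r'(1+\frac{\log_q P}{N})}{1-\frac4N}$ | $\frac{2r(1+\log_q P)}{1-\frac4N}$ | $\max\{O(\frac{L^2}{B}),O(N^2B^2)\}$ | $H(\tilde X_1,\dots,\tilde X_B)$ | | 4 | MDS coded, within and inter-segment | $\frac{5r'(1+\frac{\log_q P}{N})}{1-\frac1N}$ | $\frac{5r(1+\log_q P)}{1-\frac1N}$ | $\max\{O(\frac{L^2}{N^2B}),O(B^2)\}$ | $H(\tilde X_1,\dots,\tilde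 X_B)$ | Moreover, in all four cases, with $G_n$ everything the user sends to database $n$ and $S_n$ the content of database $n$ (data and reversing matrices): * Reading correctness: the chosen subpackets are decoded without error from the $N$ answers. * Writing correctness: after the round the databases store, in the same form and with the same permutations, the model in which the $Pr$ subpackets in $X$ are increased by their updates and all others are unchanged. * Security: $I(W;S_n)=0$ for every $n$, both before the round and after it (with the updated model and storage). * Privacy of the values: $I(\Delta;(S_n,G_n)\mid X)=0$ for every $n$, where $S_n$ is taken before the writing phase; and every function $\varphi(\Delta)$ of the update values that is independent of $X$, such as a single value $\Delta_i$, satisfies $I(\varphi(\Delta);G_n)=0$. * Leakage about the positions: $I(X;G_n)=I(X;(S_n,G_n))$, with $S_n$ before the writing phase, equals the entropy in the last column, for every $n$. -/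

import Mathlib

universe u

namespace PRUW

/-! ### Shannon quantities of discrete random variables

A random variable is a function on a discrete probability space `(Ω, p)`.  In every use below the
sample space is finite, so that the sums are finite.  Entropies are measured in nats. -/

/-- Shannon entropy `H(X)`. -/
noncomputable def entropy {Ω α : Type*} (p : PMF Ω) (X : Ω → α) : ℝ :=
  ∑' a, Real.negMulLog ((p.map X) a).toReal

/-- Mutual information `I(X; Y) = H(X) + H(Y) - H(X, Y)`. -/
noncomputable def mutualInfo {Ω α β : Type*} (p : PMF Ω) (X : Ω → α) (Y : Ω → β) : ℝ :=
  entropy p X + entropy p Y - entropy p (fun ω => (X ω, Y ω))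

/-- Conditional mutual information `I(X; Y | Z) = H(X, Z) + H(Y, Z) - H(X, Y, Z) - H(Z)`. -/
noncomputable def condMutualInfo {Ω α β γ : Type*} (p : PMF Ω) (X : Ω → α) (Y : Ω → β)
    (Z : Ω → γ) : ℝ :=
  entropy p (fun ω => (X ω, Z ω)) + entropy p (fun ω => (Y ω, Z ω))
    - entropy p (fun ω => (X ω, Y ω, Z ω)) - entropy p Z

/-! ### The model, the sparse updates and their positions

There are `B` segments of `m` subpackets (`P = B * m`), and `ℓ` parameters per subpacket
(`L = P * ℓ`). -/

/-- Index of a subpacket: (segment, subpacket within the segment). -/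
abbrev Sub (B m : ℕ) : Type := Fin B × Fin m

/-- Values of all parameters of the model. -/
abbrev Model (F : Type u) (B m ℓ : ℕ) : Type u := Sub B m → Fin ℓ → F

/-- The possible sets of indices of `K` sparse subpackets. -/
abbrev Positions (B m K : ℕ) : Type := {x : Finset (Sub B m) // x.card = K}

/-- The values of the sparse updates: `ℓ` values for each of the `K` chosen subpackets. -/
abbrev Values (F : Type u) (ℓ K : ℕ) : Type u := Fin K → Fin ℓ → F

/-- The `i`-th element of a set of subpacket indices, in the order of the linear index
`segment * m + subpacket`. -/
def Positions.nth {B m K : ℕ} (x : Positions B m K) (i : Fin K) : Sub B m :=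
  finProdFinEquiv.symm
    ((x.1.map finProdFinEquiv.toEmbedding).orderEmbOfFin
      ((Finset.card_map _).trans x.2) i)

/-- The set of permuted indices of the subpackets in `x`, where `σ` sends each permuted index to
the real index. -/
def Positions.permuted {B m K : ℕ} (σ : Equiv.Perm (Sub B m)) (x : Positions B m K) :
    Positions B m K :=
  ⟨x.1.map σ.symm.toEmbedding, (Finset.card_map _).trans x.2⟩

/-- The sparse update of the whole model: the `i`-th subpacket of `x` is changed by `δ i`, and the
subpackets outside `x` are not changed. -/
def sparseUpdate {F : Type u} [Field F] {B m ℓ K : ℕ} (x : Positions B m K) (δ : Values F ℓ K) :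
    Model F B m ℓ :=
  fun s k => ∑ i : Fin K, if x.nth i = s then δ i k else 0

/-- `(X̂₁, …, X̂_B)`: the numbers of sparse subpackets in the segments. -/
def segCounts {B m K : ℕ} (x : Positions B m K) : Fin B → ℕ :=
  fun j => (x.1.filter (fun s => s.1 = j)).card

/-- `(X̃₁, …, X̃_B)`: the numbers of sparse subpackets in the segments, irrespective of the order
of the segments. -/
def unorderedCounts {B m K : ℕ} (x : Positions B m K) : Multiset ℕ :=
  Finset.univ.val.map (segCounts x)

/-! ### Schemes for one round of read-update-write, and what is required of them -/

/-- A scheme for a single user and a single round.  `Ku` is the number of subpackets that are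
updated (uplink), `Kd` the number of subpackets that are downloaded (downlink).

A coordinator draws a uniform key, shared with the users but not with the databases, and uniform
noise, and fills the databases.  In the reading phase the databases choose `Kd` permuted indices,
one designated database sends these indices to the user, and each database sends an answer that it
computes from its own content.  In the writing phase the user uploads a message to each database,
using the key and uniform noise of its own, and each database updates its own content. -/
structure Scheme (F : Type u) (N B m ℓ Ku Kd : ℕ) where
  /-- what the coordinator shares with the users -/
  Key : Type
  /-- noise of the coordinator -/
  Noise : Type u
  /-- noise of the user -/
  UserNoise : Type u
  /-- content of one database -/
  Store : Type u
  /-- answer of one database in the reading phase -/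
  Answer : Type u
  /-- message from the user to one database in the writing phase -/
  Upload : Type u
  [keyFintype : Fintype Key]
  [keyNonempty : Nonempty Key]
  [noiseFintype : Fintype Noise]
  [noiseNonempty : Nonempty Noise]
  [userNoiseFintype : Fintype UserNoise]
  [userNoiseNonempty : Nonempty UserNoise]
  [storeFintype : Fintype Store]
  [answerFintype : Fintype Answer]
  [uploadFintype : Fintype Upload]
  /-- the real index behind each permuted index -/
  realIdx : Key → Equiv.Perm (Sub B m)
  /-- content placed in database `n` -/
  store : Fin N → Model F B m ℓ → Key → Noise → Store
  /-- answer of database `n`, given the chosen permuted indices -/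
  answer : Fin N → Store → (Fin Kd → Sub B m) → Answer
  /-- message to database `n` -/
  upload : Fin N → Key → UserNoise → Positions B m Ku → Values F ℓ Ku → Upload
  /-- content of database `n` after the writing phase -/
  update : Fin N → Store → Upload → Store

attribute [instance] Scheme.keyFintype Scheme.keyNonempty Scheme.noiseFintype
  Scheme.noiseNonempty Scheme.userNoiseFintype Scheme.userNoiseNonempty Scheme.storeFintype
  Scheme.answerFintype Scheme.uploadFintype

/-- The data of a round: the model `W` before the round, the set `X` of positions of the sparse
updates, and the values of the sparse updates. -/
abbrev Data (F : Type u) (B m ℓ Ku : ℕ) : Type u :=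
  Model F B m ℓ × Positions B m Ku × Values F ℓ Ku

namespace Scheme

/-- Sample space of a round: data, key, noise of the coordinator, noise of the user. -/
abbrev Sample {F : Type u} {N B m ℓ Ku Kd : ℕ} (S : Scheme F N B m ℓ Ku Kd) : Type u :=
  Data F B m ℓ Ku × S.Key × S.Noise × S.UserNoise

/-- Law of a round: the data have an arbitrary joint law `p`; the key and the noises are uniform,
mutually independent, and independent of the data. -/
noncomputable def law {F : Type u} {N B m ℓ Ku Kd : ℕ} (S : Scheme F N B m ℓ Ku Kd)
    (p : PMF (Data F B m ℓ Ku)) : PMF S.Sample :=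
  p.bind fun d =>
    (PMF.uniformOfFintype (S.Key × S.Noise × S.UserNoise)).map fun ρ => (d, ρ)

/-- `W` before the round. -/
def modelBefore {F : Type u} {N B m ℓ Ku Kd : ℕ} (S : Scheme F N B m ℓ Ku Kd) (ω : S.Sample) :
    Model F B m ℓ := ω.1.1

/-- `X`, the positions of the sparse updates. -/
def positions {F : Type u} {N B m ℓ Ku Kd : ℕ} (S : Scheme F N B m ℓ Ku Kd) (ω : S.Sample) :
    Positions B m Ku := ω.1.2.1

/-- The values of the sparse updates. -/
def values {F : Type u} {N B m ℓ Ku Kd : ℕ} (S : Scheme F N B m ℓ Ku Kd) (ω : S.Sample) :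
    Values F ℓ Ku := ω.1.2.2

/-- `W` after the round. -/
def modelAfter {F : Type u} [Field F] {N B m ℓ Ku Kd : ℕ} (S : Scheme F N B m ℓ Ku Kd)
    (ω : S.Sample) : Model F B m ℓ :=
  S.modelBefore ω + sparseUpdate (S.positions ω) (S.values ω)

/-- Content of database `n` before the writing phase. -/
def storeBefore {F : Type u} {N B m ℓ Ku Kd : ℕ} (S : Scheme F N B m ℓ Ku Kd) (n : Fin N)
    (ω : S.Sample) : S.Store :=
  S.store n (S.modelBefore ω) ω.2.1 ω.2.2.1

/-- `G_n`, everything that the user sends to database `n`. -/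
def sent {F : Type u} {N B m ℓ Ku Kd : ℕ} (S : Scheme F N B m ℓ Ku Kd) (n : Fin N)
    (ω : S.Sample) : S.Upload :=
  S.upload n ω.2.1 ω.2.2.2 (S.positions ω) (S.values ω)

/-- Content of database `n` after the writing phase. -/
def storeAfter {F : Type u} {N B m ℓ Ku Kd : ℕ} (S : Scheme F N B m ℓ Ku Kd) (n : Fin N)
    (ω : S.Sample) : S.Store :=
  S.update n (S.storeBefore n ω) (S.sent n ω)

/-- Correctness in the reading phase: whatever permuted indices the databases choose, the
subpackets with these indices can be decoded without error from the `N` answers. -/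
def ReadCorrect {F : Type u} {N B m ℓ Ku Kd : ℕ} (S : Scheme F N B m ℓ Ku Kd) : Prop :=
  ∃ dec : (Fin Kd → Sub B m) → (Fin N → S.Answer) → Fin Kd → Fin ℓ → F,
    ∀ (w : Model F B m ℓ) (k : S.Key) (z : S.Noise) (V : Fin Kd → Sub B m),
      dec V (fun n => S.answer n (S.store n w k z) V) = fun i => w (S.realIdx k (V i))

/-- Correctness in the writing phase: after the round the databases store, in the form of the
initial storage with the same key, the model `W + Δ`. -/
def WriteCorrect {F : Type u} [Field F] {N B m ℓ Ku Kd : ℕ} (S : Scheme F N B m ℓ Ku Kd) : Prop :=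
  ∀ (w : Model F B m ℓ) (k : S.Key) (z : S.Noise) (u : S.UserNoise) (x : Positions B m Ku)
    (δ : Values F ℓ Ku), ∃ z₁ : S.Noise, ∀ n : Fin N,
      S.update n (S.store n w k z) (S.upload n k u x δ) = S.store n (w + sparseUpdate x δ) k z₁

/-- Security of the model: the content of each database, before and after the round, carries no
information about the model stored at that time. -/
def Secure {F : Type u} [Field F] {N B m ℓ Ku Kd : ℕ} (S : Scheme F N B m ℓ Ku Kd) : Prop :=
  ∀ (p : PMF (Data F B m ℓ Ku)) (n : Fin N),
    mutualInfo (S.law p) S.modelBefore (S.storeBefore n) = 0 ∧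
    mutualInfo (S.law p) S.modelAfter (S.storeAfter n) = 0

/-- Privacy of the values of the sparse updates: given the positions, what database `n` stores
and receives carries no information about the values; and what the user sends to database `n`
carries no information about any function of the values (one value, the values of one subpacket,
all of them) that is independent of the positions. -/
def ValuesPrivate {F : Type u} {N B m ℓ Ku Kd : ℕ} (S : Scheme F N B m ℓ Ku Kd) : Prop :=
  ∀ (p : PMF (Data F B m ℓ Ku)) (n : Fin N),
    condMutualInfo (S.law p) S.values (fun ω => (S.storeBefore n ω, S.sent n ω)) S.positions = 0 ∧
    ∀ (T : Type u) (φ : Values F ℓ Ku → T),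
      mutualInfo (S.law p) (fun ω => φ (S.values ω)) S.positions = 0 →
      mutualInfo (S.law p) (fun ω => φ (S.values ω)) (S.sent n) = 0

/-- The information leaked to each database about the positions of the sparse updates is exactly
the entropy of `stat X`; this holds for what the user sends, and also for what the user sends
together with the content of the database. -/
def PositionLeakage {F : Type u} {N B m ℓ Ku Kd : ℕ} (S : Scheme F N B m ℓ Ku Kd) {T : Type*}
    (stat : Positions B m Ku → T) : Prop :=
  ∀ (p : PMF (Data F B m ℓ Ku)) (n : Fin N),
    mutualInfo (S.law p) S.positions (S.sent n) =
      entropy (S.law p) (fun ω => stat (S.positions ω)) ∧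
    mutualInfo (S.law p) S.positions (fun ω => (S.storeBefore n ω, S.sent n ω)) =
      entropy (S.law p) (fun ω => stat (S.positions ω))

/-- Number of `q`-ary symbols needed for an element of a finite type `A`. -/
noncomputable def symbols (F A : Type*) [Fintype F] [Fintype A] : ℝ :=
  Real.logb (Fintype.card F) (Fintype.card A)

/-- Reading cost: the symbols downloaded (one answer per database, and the permuted indices from
one designated database) over the size of the model. -/
noncomputable def readingCost {F : Type u} [Fintype F] {N B m ℓ Ku Kd : ℕ}
    (S : Scheme F N B m ℓ Ku Kd) : ℝ :=
  ((∑ _n : Fin N, symbols F S.Answer) + symbols F (Fin Kd → Sub B m)) / ((B * m * ℓ : ℕ) : ℝ)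

/-- Writing cost: the symbols uploaded to all databases over the size of the model. -/
noncomputable def writingCost {F : Type u} [Fintype F] {N B m ℓ Ku Kd : ℕ}
    (S : Scheme F N B m ℓ Ku Kd) : ℝ :=
  (∑ _n : Fin N, symbols F S.Upload) / ((B * m * ℓ : ℕ) : ℝ)

/-- Number of symbols stored in each database. -/
noncomputable def storageSize {F : Type u} [Fintype F] {N B m ℓ Ku Kd : ℕ}
    (S : Scheme F N B m ℓ Ku Kd) : ℝ :=
  symbols F S.Store

/-- The scheme is correct and secure, keeps the values of the updates private, leaks `H(stat X)`
about the positions, and has reading cost `CR` and writing cost `CW`. -/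
structure Achieves {F : Type u} [Field F] [Fintype F] {N B m ℓ Ku Kd : ℕ}
    (S : Scheme F N B m ℓ Ku Kd) {T : Type*} (stat : Positions B m Ku → T) (CR CW : ℝ) : Prop where
  readCorrect : S.ReadCorrect
  writeCorrect : S.WriteCorrect
  secure : S.Secure
  valuesPrivate : S.ValuesPrivate
  positionLeakage : S.PositionLeakage stat
  readingCost_eq : S.readingCost = CR
  writingCost_eq : S.writingCost = CW

end Scheme

/-! ### Building blocks of the four schemes -/

/-- Permutation reversing matrix: column `b` has its `1` in row `σ b`. -/
def permRev (F : Type u) [Field F] {a : ℕ} (σ : Equiv.Perm (Fin a)) : Matrix (Fin a) (Fin a) F :=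
  Matrix.of fun i j => if i = σ j then 1 else 0

/-- Within-segment permutations: permuted subpacket `t` of segment `j` is the real subpacket
`π j t` of segment `j`. -/
def withinIdx {B m : ℕ} (π : Fin B → Equiv.Perm (Fin m)) : Equiv.Perm (Sub B m) :=
  Equiv.prodShear (Equiv.refl _) π

/-- Within- and inter-segment permutations: the permuted pair `(φ, η)` is the real pair
`(σ φ, π (σ φ) η)`. -/
def twoStageIdx {B m : ℕ} (π : Fin B → Equiv.Perm (Fin m)) (σ : Equiv.Perm (Fin B)) :
    Equiv.Perm (Sub B m) :=
  Equiv.prodShear σ fun φ => π (σ φ)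

/-- A message of `K` (update, permuted index) tuples.  The tuples are listed by increasing
permuted index, so that their order carries no further information. -/
abbrev Tuples (F : Type u) (B m K : ℕ) : Type u := Fin K → F × Sub B m

/-- The user's message: `comb` combines the updates of one subpacket with one noise symbol. -/
def tuples {F : Type u} [Field F] {B m ℓ K : ℕ} (comb : (Fin ℓ → F) → F → F)
    (σ : Equiv.Perm (Sub B m)) (u : Fin K → F) (x : Positions B m K) (δ : Values F ℓ K) :
    Tuples F B m K :=
  fun i =>
    (comb (sparseUpdate x δ (σ ((x.permuted σ).nth i))) (u i), (x.permuted σ).nth i)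

/-- Permuted update vector built by a database from the tuples that it receives. -/
def updateVector {F : Type u} [Field F] {B m K : ℕ} (G : Tuples F B m K) : Sub B m → F :=
  fun s => ∑ i : Fin K, if (G i).2 = s then (G i).1 else 0

/-- Uncoded storage of one parameter: `w / (f - a) + ∑ⱼ aʲ zⱼ`. -/
def uncodedSymbol {F : Type u} [Field F] {d : ℕ} (f a w : F) (z : Fin d → F) : F :=
  (f - a)⁻¹ * w + ∑ j : Fin d, a ^ (j : ℕ) * z j

/-- MDS coded storage of one subpacket: `∑ᵢ wᵢ / aⁱ + ∑ⱼ aʲ zⱼ`, with `i = 1, …, ℓ`. -/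
def codedSymbol {F : Type u} [Field F] {ℓ d : ℕ} (a : F) (w : Fin ℓ → F) (z : Fin d → F) : F :=
  (∑ i : Fin ℓ, (a ^ ((i : ℕ) + 1))⁻¹ * w i) + ∑ j : Fin d, a ^ (j : ℕ) * z j

/-- Combined update for uncoded storage. -/
def uncodedComb {F : Type u} [Field F] {ℓ : ℕ} (f : Fin ℓ → F) (a : F) (δ : Fin ℓ → F) (z : F) :
    F :=
  (∑ k : Fin ℓ, (∏ j ∈ Finset.univ.erase k, (f j - a)) *
      (δ k / ∏ j ∈ Finset.univ.erase k, (f j - f k)))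
    + (∏ j : Fin ℓ, (f j - a)) * z

/-- Combined update for MDS coded storage. -/
def codedComb {F : Type u} [Field F] {ℓ : ℕ} (a : F) (δ : Fin ℓ → F) (z : F) : F :=
  (∑ k : Fin ℓ, (a ^ ((k : ℕ) + 1))⁻¹ * δ k) + z

/-- Noisy within-segment permutation reversing matrix `(R ⊗ Γ) + Z`, where `Γ` is the diagonal
matrix with entries `1 / (f k - a)`. -/
def uncodedRev {F : Type u} [Field F] {m ℓ : ℕ} (f : Fin ℓ → F) (a : F) (π : Equiv.Perm (Fin m))
    (Z : Matrix (Fin m × Fin ℓ) (Fin m × Fin ℓ) F) : Matrix (Fin m × Fin ℓ) (Fin m × Fin ℓ) F :=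
  Matrix.kroneckerMap (· * ·) (permRev F π) (Matrix.diagonal fun k => (f k - a)⁻¹) + Z

/-- Noisy inter-segment permutation reversing matrix `(R ⊗ I) + (I ⊗ Γ⁻¹) Z`. -/
def uncodedInterRev {F : Type u} [Field F] {B ℓ : ℕ} (f : Fin ℓ → F) (a : F)
    (σ : Equiv.Perm (Fin B)) (Z : Matrix (Fin B × Fin ℓ) (Fin B × Fin ℓ) F) :
    Matrix (Fin B × Fin ℓ) (Fin B × Fin ℓ) F :=
  Matrix.kroneckerMap (· * ·) (permRev F σ) (1 : Matrix (Fin ℓ) (Fin ℓ) F)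
    + Matrix.kroneckerMap (· * ·) (1 : Matrix (Fin B) (Fin B) F)
        (Matrix.diagonal fun k => f k - a) * Z

/-- Noisy permutation reversing matrix `R + a ^ ℓ Z` for coded storage. -/
def codedRev {F : Type u} [Field F] {b : ℕ} (ℓ : ℕ) (a : F) (π : Equiv.Perm (Fin b))
    (Z : Matrix (Fin b) (Fin b) F) : Matrix (Fin b) (Fin b) F :=
  permRev F π + a ^ ℓ • Z

/-- Combined matrix for uncoded storage: the block diagonal matrix of the `R i` times the matrix
whose `(i, j)` block is `I ⊗ b i j`, where `b i j` is the `(i, j)` block of size `ℓ × ℓ` of `H`. -/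
def uncodedCombined {F : Type u} [Field F] {B m ℓ : ℕ}
    (R : Fin B → Matrix (Fin m × Fin ℓ) (Fin m × Fin ℓ) F)
    (H : Matrix (Fin B × Fin ℓ) (Fin B × Fin ℓ) F) :
    Matrix (Sub B m × Fin ℓ) (Sub B m × Fin ℓ) F :=
  Matrix.of fun a b => ∑ h : Fin ℓ, R a.1.1 (a.1.2, a.2) (b.1.2, h) * H (a.1.1, h) (b.1.1, b.2)

/-- Combined matrix for coded storage: the block diagonal matrix of the `R i` times `H ⊗ I`. -/
def codedCombined {F : Type u} [Field F] {B m : ℕ} (R : Fin B → Matrix (Fin m) (Fin m) F)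
    (H : Matrix (Fin B) (Fin B) F) : Matrix (Sub B m) (Sub B m) F :=
  Matrix.of fun a b => R a.1 a.2 b.2 * H a.1 b.1

/-! ### The four schemes -/

/-- Case 1: uncoded storage, within-segment permutations. -/
def scheme1 {F : Type u} [Field F] [Fintype F] {N ℓ : ℕ} (f : Fin ℓ → F) (α : Fin N → F)
    (B m Ku Kd : ℕ) : Scheme F N B m ℓ Ku Kd where
  Key := Fin B → Equiv.Perm (Fin m)
  Noise := (Sub B m → Fin ℓ → Fin (ℓ + 1) → F) ×
    (Fin B → Matrix (Fin m × Fin ℓ) (Fin m × Fin ℓ) F)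
  UserNoise := Fin Ku → F
  Store := (Sub B m → Fin ℓ → F) × (Fin B → Matrix (Fin m × Fin ℓ) (Fin m × Fin ℓ) F)
  Answer := Fin Kd → F
  Upload := Tuples F B m Ku
  realIdx := withinIdx
  store n w π z :=
    (fun s k => uncodedSymbol (f k) (α n) (w s k) (z.1 s k),
     fun j => uncodedRev f (α n) (π j) (z.2 j))
  answer n S V i :=
    -- the query is the sum of the `ℓ` columns that belong to the permuted index
    ∑ s : Fin m, ∑ k : Fin ℓ, ((f k - α n) * S.1 ((V i).1, s) k) *
      ∑ h : Fin ℓ, S.2 (V i).1 (s, k) ((V i).2, h)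
  upload n π u x δ := tuples (uncodedComb f (α n)) (withinIdx π) u x δ
  update _ S G :=
    (fun s k => S.1 s k +
      (S.2 s.1).mulVec (fun b : Fin m × Fin ℓ => updateVector G (s.1, b.1)) (s.2, k),
     S.2)

/-- Case 2: MDS coded storage, within-segment permutations. -/
def scheme2 {F : Type u} [Field F] [Fintype F] {N : ℕ} (α : Fin N → F)
    (B m ℓ Ku Kd : ℕ) : Scheme F N B m ℓ Ku Kd where
  Key := Fin B → Equiv.Perm (Fin m)
  Noise := (Sub B m → Fin (ℓ + 1) → F) × (Fin B → Matrix (Fin m) (Fin m) F)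
  UserNoise := Fin Ku → F
  Store := (Sub B m → F) × (Fin B → Matrix (Fin m) (Fin m) F)
  Answer := Fin Kd → F
  Upload := Tuples F B m Ku
  realIdx := withinIdx
  store n w π z :=
    (fun s => codedSymbol (α n) (w s) (z.1 s),
     fun j => codedRev ℓ (α n) (π j) (z.2 j))
  answer _ S V i := ∑ s : Fin m, S.1 ((V i).1, s) * S.2 (V i).1 s (V i).2
  upload n π u x δ := tuples (codedComb (α n)) (withinIdx π) u x δ
  update _ S G :=
    (fun s => S.1 s + (S.2 s.1).mulVec (fun t : Fin m => updateVector G (s.1, t)) s.2,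
     S.2)

/-- Case 3: uncoded storage, within- and inter-segment permutations. -/
def scheme3 {F : Type u} [Field F] [Fintype F] {N ℓ : ℕ} (f : Fin ℓ → F) (α : Fin N → F)
    (B m Ku Kd : ℕ) : Scheme F N B m ℓ Ku Kd where
  Key := (Fin B → Equiv.Perm (Fin m)) × Equiv.Perm (Fin B)
  Noise := (Sub B m → Fin ℓ → Fin (ℓ + 2) → F) ×
    (Fin B → Matrix (Fin m × Fin ℓ) (Fin m × Fin ℓ) F) ×
    Matrix (Fin B × Fin ℓ) (Fin B × Fin ℓ) F
  UserNoise := Fin Ku → F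
  Store := (Sub B m → Fin ℓ → F) × (Fin B → Matrix (Fin m × Fin ℓ) (Fin m × Fin ℓ) F) ×
    Matrix (Fin B × Fin ℓ) (Fin B × Fin ℓ) F
  Answer := Fin Kd → F
  Upload := Tuples F B m Ku
  realIdx κ := twoStageIdx κ.1 κ.2
  store n w κ z :=
    (fun s k => uncodedSymbol (f k) (α n) (w s k) (z.1 s k),
     fun j => uncodedRev f (α n) (κ.1 j) (z.2.1 j),
     uncodedInterRev f (α n) κ.2 z.2.2)
  answer n S V i :=
    -- the query is `I ⊗ Γ⁻¹` times the sum of the `ℓ` columns of the permuted index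
    ∑ s : Sub B m, ∑ k : Fin ℓ, S.1 s k *
      ((f k - α n) * ∑ h : Fin ℓ, uncodedCombined S.2.1 S.2.2 (s, k) (V i, h))
  upload n κ u x δ := tuples (uncodedComb f (α n)) (twoStageIdx κ.1 κ.2) u x δ
  update _ S G :=
    (fun s k => S.1 s k +
      (uncodedCombined S.2.1 S.2.2).mulVec
        (fun b : Sub B m × Fin ℓ => updateVector G b.1) (s, k),
     S.2)

/-- Case 4: MDS coded storage, within- and inter-segment permutations. -/
def scheme4 {F : Type u} [Field F] [Fintype F] {N : ℕ} (α : Fin N → F)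
    (B m ℓ Ku Kd : ℕ) : Scheme F N B m ℓ Ku Kd where
  Key := (Fin B → Equiv.Perm (Fin m)) × Equiv.Perm (Fin B)
  Noise := (Sub B m → Fin (2 * ℓ + 1) → F) × (Fin B → Matrix (Fin m) (Fin m) F) ×
    Matrix (Fin B) (Fin B) F
  UserNoise := Fin Ku → F
  Store := (Sub B m → F) × (Fin B → Matrix (Fin m) (Fin m) F) × Matrix (Fin B) (Fin B) F
  Answer := Fin Kd → F
  Upload := Tuples F B m Ku
  realIdx κ := twoStageIdx κ.1 κ.2
  store n w κ z :=
    (fun s => codedSymbol (α n) (w s) (z.1 s),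
     fun j => codedRev ℓ (α n) (κ.1 j) (z.2.1 j),
     codedRev ℓ (α n) κ.2 z.2.2)
  answer _ S V i := ∑ s : Sub B m, S.1 s * codedCombined S.2.1 S.2.2 s (V i)
  upload n κ u x δ := tuples (codedComb (α n)) (twoStageIdx κ.1 κ.2) u x δ
  update _ S G :=
    (fun s => S.1 s + (codedCombined S.2.1 S.2.2).mulVec (updateVector G) s,
     S.2)

end PRUW

-- The theorem separates into polynomial algebra in the evaluation points `α n`, which gives
-- correctness, and bijections of the randomness, which give all the information-theoretic claims.
--
-- Algebra. Regard a quantity held by the databases as a function of `n`, modulo `polyFun α d`, the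
-- polynomials of degree at most `d` in `α n` ("interference"). Storage is then a sum of simple
-- poles `w k / (f k - α n)` in the uncoded cases and of powers `w i / α n ^ i` in the coded cases,
-- and a noisy reversing matrix is the true one in a form where the noise contributes only
-- interference. Multiplying out shows that an answer is the requested subpacket, and that the
-- increment of the storage is the update, each modulo interference of a known degree. After the
-- denominators are cleared, a polynomial of degree at most `d + ℓ` that vanishes at more than `d +
-- ℓ` points is zero; so the answers determine the subpacket as soon as `d + ℓ < N`. This is where
-- the four relations between `N` and `ℓ` come from. On the writing side the interference has at
-- most the degree of the noise polynomial in the storage, so it only shifts the storage noise and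
-- the form of the storage is preserved.
--
-- Information. The data have an arbitrary law and the randomness is uniform and independent of
-- them. If a permutation of the randomness carries an observation made under data `d` to the one
-- made under `d'` (`Coupled`), then the two conditional laws agree. Additive noise couples the
-- contents of one database for any two models and keys (`StorePadded`); the user's noise hides the
-- values once the permuted positions agree (`UploadPadded`); translation in the permutation group
-- couples any two position sets with the same statistic (`KeyPadded`). Since one database is
-- observed at a time, the coupling may depend on `n`. Conversely, the permuted indices reveal the
-- statistic (`UploadReveals`), so the leakage is exactly its entropy. Security after the round
-- conjugates the coupling of the storage by the shift of the noise that writing causes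
-- (`WritePadded`).
--
-- The costs follow from counting symbols and from `1 - a / N = c * ℓ / N` when `N = c * ℓ + a`.

namespace PRUW

/-! ### Probabilities of values of random variables -/

/-- The probability `P(X = a)` as a real number. -/
noncomputable def prob {Ω α : Type*} (p : PMF Ω) (X : Ω → α) (a : α) : ℝ :=
  ((p.map X) a).toReal

section Finite

open Classical

theorem PMF_sum_toReal {Ω : Type*} [Fintype Ω] (p : PMF Ω) : ∑ ω, (p ω).toReal = 1 := by
  rw [← ENNReal.toReal_sum fun ω _ => p.apply_ne_top ω, ← tsum_fintype (L := .unconditional _),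
    p.tsum_coe, ENNReal.toReal_one]

theorem prob_eq_sum {Ω α : Type*} [Fintype Ω] (p : PMF Ω) (X : Ω → α) (a : α) :
    prob p X a = ∑ ω, if X ω = a then (p ω).toReal else 0 := by
  rw [prob, PMF.map_apply, tsum_fintype, ENNReal.toReal_sum]
  · refine Finset.sum_congr rfl fun ω _ => ?_
    by_cases h : X ω = a
    · simp [h]
    · rw [if_neg h, if_neg (fun h' => h h'.symm), ENNReal.toReal_zero]
  · intro ω _
    split_ifs
    · exact p.apply_ne_top ω
    · exact ENNReal.zero_ne_top

theorem prob_nonneg {Ω α : Type*} (p : PMF Ω) (X : Ω → α) (a : α) : 0 ≤ prob p X a :=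
  ENNReal.toReal_nonneg

theorem prob_apply_pos {Ω α : Type*} [Fintype Ω] {p : PMF Ω} (X : Ω → α) {ω : Ω}
    (h : (p ω).toReal ≠ 0) : 0 < prob p X (X ω) := by
  rw [prob_eq_sum]
  refine Finset.sum_pos' (fun i _ => ?_) ⟨ω, Finset.mem_univ _, ?_⟩
  · split_ifs
    · exact ENNReal.toReal_nonneg
    · exact le_rfl
  · rw [if_pos rfl]
    exact lt_of_le_of_ne ENNReal.toReal_nonneg h.symm

theorem prob_eq_zero_of_notMem {Ω α : Type*} [Fintype Ω] [DecidableEq α] (p : PMF Ω)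
    (X : Ω → α) {a : α}
    (h : a ∉ Finset.univ.image X) : prob p X a = 0 := by
  rw [prob_eq_sum]
  refine Finset.sum_eq_zero fun ω _ => if_neg ?_
  rintro rfl
  exact h (Finset.mem_image_of_mem _ (Finset.mem_univ _))

theorem sum_prob_mul {Ω α : Type*} [Fintype Ω] [DecidableEq α] (p : PMF Ω) (X : Ω → α)
    (g : α → ℝ) :
    ∑ a ∈ Finset.univ.image X, prob p X a * g a = ∑ ω, (p ω).toReal * g (X ω) := by
  rw [← Finset.sum_fiberwise_of_maps_to
    (fun ω _ => Finset.mem_image_of_mem X (Finset.mem_univ ω)) (fun ω => (p ω).toReal * g (X ω))]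
  refine Finset.sum_congr rfl fun a _ => ?_
  rw [prob_eq_sum, Finset.sum_mul, Finset.sum_filter]
  refine Finset.sum_congr rfl fun ω _ => ?_
  by_cases h : X ω = a
  · rw [if_pos h, if_pos h, h]
  · rw [if_neg h, if_neg h, zero_mul]

theorem sum_prob {Ω α : Type*} [Fintype Ω] [DecidableEq α] (p : PMF Ω) (X : Ω → α) :
    ∑ a ∈ Finset.univ.image X, prob p X a = 1 := by
  simpa [PMF_sum_toReal] using sum_prob_mul p X fun _ => 1

/-- The entropy is the expectation of the information content. -/
theorem entropy_eq_sum {Ω α : Type*} [Fintype Ω] (p : PMF Ω) (X : Ω → α) :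
    entropy p X = ∑ ω, (p ω).toReal * -Real.log (prob p X (X ω)) := by
  rw [← sum_prob_mul p X fun a => -Real.log (prob p X a), entropy,
    tsum_eq_sum (s := Finset.univ.image X)]
  · refine Finset.sum_congr rfl fun a _ => ?_
    rw [Real.negMulLog, ← prob]
    ring
  · intro a ha
    rw [← prob, prob_eq_zero_of_notMem p X ha, Real.negMulLog_zero]

/-- Taking logarithms of the pointwise identity and then expectations gives `H(X) + H(Y) - H(X, Y) =
H(T)`. Samples of probability zero, where a logarithm of zero could occur, have weight zero. -/
theorem mutualInfo_eq_of_prob {Ω α β γ : Type*} [Fintype Ω] (p : PMF Ω) (X : Ω → α) (Y : Ω → β)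
    (T : Ω → γ)
    (h : ∀ ω, prob p (fun ω => (X ω, Y ω)) (X ω, Y ω) * prob p T (T ω) =
      prob p X (X ω) * prob p Y (Y ω)) :
    mutualInfo p X Y = entropy p T := by
  rw [mutualInfo]
  simp only [entropy_eq_sum]
  rw [← Finset.sum_add_distrib, ← Finset.sum_sub_distrib]
  refine Finset.sum_congr rfl fun ω _ => ?_
  by_cases h0 : (p ω).toReal = 0
  · simp [h0]
  have hl := congrArg Real.log (h ω)
  rw [Real.log_mul (prob_apply_pos (fun ω => (X ω, Y ω)) h0).ne' (prob_apply_pos T h0).ne',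
    Real.log_mul (prob_apply_pos X h0).ne' (prob_apply_pos Y h0).ne'] at hl
  linear_combination (p ω).toReal * hl

theorem entropy_const {Ω γ : Type*} [Fintype Ω] (p : PMF Ω) (c : γ) :
    entropy p (fun _ => c) = 0 := by
  rw [entropy_eq_sum]
  have : prob p (fun _ => c) c = 1 := by simp [prob_eq_sum, PMF_sum_toReal]
  simp [this]

theorem mutualInfo_eq_zero_of_prob {Ω α β : Type*} [Fintype Ω] (p : PMF Ω) (X : Ω → α)
    (Y : Ω → β)
    (h : ∀ ω, prob p (fun ω => (X ω, Y ω)) (X ω, Y ω) = prob p X (X ω) * prob p Y (Y ω)) :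
    mutualInfo p X Y = 0 := by
  rw [mutualInfo_eq_of_prob p X Y (fun _ => ()) fun ω => ?_, entropy_const]
  have : prob p (fun _ => ()) () = 1 := by simp [prob_eq_sum, PMF_sum_toReal]
  rw [this, mul_one, h]

theorem condMutualInfo_eq_zero_of_prob {Ω α β γ : Type*} [Fintype Ω] (p : PMF Ω) (X : Ω → α)
    (Y : Ω → β) (Z : Ω → γ)
    (h : ∀ ω, prob p (fun ω => (X ω, Y ω, Z ω)) (X ω, Y ω, Z ω) * prob p Z (Z ω) =
      prob p (fun ω => (X ω, Z ω)) (X ω, Z ω) * prob p (fun ω => (Y ω, Z ω)) (Y ω, Z ω)) :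
    condMutualInfo p X Y Z = 0 := by
  rw [condMutualInfo]
  simp only [entropy_eq_sum]
  rw [← Finset.sum_add_distrib, ← Finset.sum_sub_distrib, ← Finset.sum_sub_distrib]
  refine Finset.sum_eq_zero fun ω _ => ?_
  by_cases h0 : (p ω).toReal = 0
  · simp [h0]
  have hl := congrArg Real.log (h ω)
  rw [Real.log_mul (prob_apply_pos (fun ω => (X ω, Y ω, Z ω)) h0).ne'
      (prob_apply_pos Z h0).ne',
    Real.log_mul (prob_apply_pos (fun ω => (X ω, Z ω)) h0).ne'
      (prob_apply_pos (fun ω => (Y ω, Z ω)) h0).ne'] at hl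
  linear_combination (p ω).toReal * hl

/-- Random variables without mutual information are independent. -/
theorem prob_pair_of_mutualInfo_eq_zero {Ω α β : Type*} [Fintype Ω] (p : PMF Ω) (X : Ω → α)
    (Y : Ω → β) (h : mutualInfo p X Y = 0) (a : α) (b : β) :
    prob p (fun ω => (X ω, Y ω)) (a, b) = prob p X a * prob p Y b := by
  set XY : Ω → α × β := fun ω => (X ω, Y ω) with hXY
  set t : α × β → ℝ := fun c => prob p X c.1 * prob p Y c.2 with ht
  set s : Finset (α × β) := Finset.univ.image X ×ˢ Finset.univ.image Y with hs
  have hsub : Finset.univ.image XY ⊆ s := by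
    intro c hc
    obtain ⟨ω, -, rfl⟩ := Finset.mem_image.1 hc
    simp [hs, hXY]
  have ht0 : ∀ c, 0 ≤ t c := fun c => mul_nonneg (prob_nonneg _ _ _) (prob_nonneg _ _ _)
  have hts : ∑ c ∈ s, t c = 1 := by
    rw [hs, Finset.sum_product]
    simp only [ht, ← Finset.mul_sum, sum_prob, mul_one]
  have hps : ∑ c ∈ s, prob p XY c = 1 := by
    rw [← sum_prob p XY]
    exact (Finset.sum_subset hsub fun c _ hc => prob_eq_zero_of_notMem p XY hc).symm
  -- Absolute continuity: the product law is positive wherever the joint law is, so the logarithms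
  -- below are genuine on the support.
  have key : ∀ ω, (p ω).toReal ≠ 0 → 0 < t (XY ω) := fun ω h0 =>
    mul_pos (prob_apply_pos X h0) (prob_apply_pos Y h0)
  have hpos : ∀ c, prob p XY c ≠ 0 → 0 < t c := by
    intro c hc
    rw [prob_eq_sum] at hc
    obtain ⟨ω, -, hω⟩ := Finset.exists_ne_zero_of_sum_ne_zero hc
    split_ifs at hω with h1
    · exact h1 ▸ key ω hω
    · exact absurd rfl hω
  -- each term of the Kullback-Leibler sum is at least `P(c) - t(c)`
  have hterm : ∀ c, prob p XY c - t c ≤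
      prob p XY c * (Real.log (prob p XY c) - Real.log (t c)) ∧
      (prob p XY c - t c = prob p XY c * (Real.log (prob p XY c) - Real.log (t c)) →
        prob p XY c = t c) := by
    intro c
    by_cases hc : prob p XY c = 0
    · rw [hc]
      refine ⟨by simpa using ht0 c, fun h => ?_⟩
      linarith
    have hP : 0 < prob p XY c := lt_of_le_of_ne (prob_nonneg _ _ _) (Ne.symm hc)
    have hT := hpos c hc
    rw [← neg_sub (Real.log (t c)), ← Real.log_div hT.ne' hc]
    have e : prob p XY c * (t c / prob p XY c) = t c := by field_simp
    constructor
    · have := mul_le_mul_of_nonneg_left (Real.log_le_sub_one_of_pos (div_pos hT hP)) hP.le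
      rw [mul_sub, e] at this
      linarith
    · intro h
      by_contra hne
      have hne' : t c / prob p XY c ≠ 1 := fun h1 => hne ((div_eq_one_iff_eq hc).1 h1).symm
      have := mul_lt_mul_of_pos_left (Real.log_lt_sub_one_of_pos (div_pos hT hP) hne') hP
      rw [mul_sub, e] at this
      linarith
  -- The Kullback-Leibler divergence from the product law is the mutual information, hence zero.
  have hsum : ∑ c ∈ s, prob p XY c * (Real.log (prob p XY c) - Real.log (t c)) = 0 := by
    rw [← Finset.sum_subset hsub fun c _ hc => by
      rw [prob_eq_zero_of_notMem p XY hc, zero_mul]]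
    rw [sum_prob_mul p XY fun c => Real.log (prob p XY c) - Real.log (t c), ← h, mutualInfo]
    simp only [entropy_eq_sum]
    rw [← Finset.sum_add_distrib, ← Finset.sum_sub_distrib]
    refine Finset.sum_congr rfl fun ω _ => ?_
    by_cases h0 : (p ω).toReal = 0
    · simp [h0]
    simp only [ht]
    rw [Real.log_mul (prob_apply_pos X h0).ne' (prob_apply_pos Y h0).ne']
    ring
  by_cases hc : (a, b) ∈ s
  · have hz := (Finset.sum_eq_sum_iff_of_le (s := s) fun c _ => (hterm c).1).1
      (by rw [Finset.sum_sub_distrib, hps, hts, hsum, sub_self])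
    exact (hterm (a, b)).2 (hz (a, b) hc)
  · rw [prob_eq_zero_of_notMem p XY fun h => hc (hsub h)]
    rw [hs, Finset.mem_product, not_and_or] at hc
    rcases hc with hc | hc
    · rw [prob_eq_zero_of_notMem p X hc, zero_mul]
    · rw [prob_eq_zero_of_notMem p Y hc, mul_zero]

/-! ### Data together with independent uniform randomness -/

/-- The joint law of data with law `p` and independent uniform randomness in `R`. -/
noncomputable def jointLaw {D R : Type*} [Fintype R] [Nonempty R] (p : PMF D) : PMF (D × R) :=
  p.bind fun d => (PMF.uniformOfFintype R).map fun ρ => (d, ρ)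

theorem jointLaw_apply {D R : Type*} [Fintype D] [Fintype R] [Nonempty R] (p : PMF D)
    (ω : D × R) :
    (jointLaw p ω).toReal = (p ω.1).toReal * (Fintype.card R : ℝ)⁻¹ := by
  obtain ⟨d, ρ⟩ := ω
  rw [jointLaw, PMF.bind_apply, tsum_fintype, Finset.sum_eq_single d, ENNReal.toReal_mul]
  · congr 1
    rw [PMF.map_apply, tsum_fintype, Finset.sum_eq_single ρ]
    · simp
    · intro b _ hb
      rw [if_neg]
      simpa using Ne.symm hb
    · simp
  · intro b _ hb
    rw [PMF.map_apply, ENNReal.tsum_eq_zero.2, mul_zero]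
    intro x
    rw [if_neg]
    simp [Ne.symm hb]
  · simp

/-- The conditional probability of the value `y` of `Y`, given the data `d`. -/
noncomputable def kernelProb {D R β : Type*} [Fintype R] (Y : D × R → β) (d : D) (y : β) : ℝ :=
  ∑ ρ, if Y (d, ρ) = y then (Fintype.card R : ℝ)⁻¹ else 0

/-- `Y` has the same conditional law given the data `d` and given the data `d'`, by a permutation
of the randomness. -/
def Coupled {D R β : Type*} (Y : D × R → β) (d d' : D) : Prop :=
  ∃ e : R ≃ R, ∀ ρ, Y (d, ρ) = Y (d', e ρ)

theorem Coupled.comp {D R β γ : Type*} {Y : D × R → β} {d d' : D} (h : Coupled Y d d')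
    (g : β → γ) : Coupled (fun ω => g (Y ω)) d d' :=
  h.imp fun _ he ρ => congrArg g (he ρ)

theorem Coupled.kernelProb_eq {D R β : Type*} [Fintype R] {Y : D × R → β} {d d' : D}
    (h : Coupled Y d d') (y : β) : kernelProb Y d y = kernelProb Y d' y := by
  obtain ⟨e, he⟩ := h
  rw [kernelProb, kernelProb, ← e.sum_comp fun ρ => if Y (d', ρ) = y then _ else _]
  simp only [he]

theorem prob_jointLaw {D R α : Type*} [Fintype D] [Fintype R] [Nonempty R] (p : PMF D)
    (Y : D × R → α) (y : α) :
    prob (jointLaw p) Y y = ∑ d, (p d).toReal * kernelProb Y d y := by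
  rw [prob_eq_sum, Fintype.sum_prod_type]
  refine Finset.sum_congr rfl fun d _ => ?_
  rw [kernelProb, Finset.mul_sum]
  refine Finset.sum_congr rfl fun ρ _ => ?_
  rw [jointLaw_apply, mul_ite, mul_zero]

/-- The common source of the factorizations below: for an event that says `v = a` and `Y = y`, the
conditional probability of `y` is a constant on `v = a` and can be taken out of the sum over the
data. Taking `U` to be a pair, or `Y` itself when `Y` determines `v`, gives the cases needed. -/
theorem prob_jointLaw_of_iff {D R α β γ : Type*} [Fintype D] [Fintype R] [Nonempty R] (p : PMF D)
    (U : D × R → α) (v : D → β) (Y : D × R → γ) {u : α} {a : β} {y : γ} {c : ℝ}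
    (hU : ∀ ω, U ω = u ↔ v ω.1 = a ∧ Y ω = y) (hc : ∀ d, v d = a → kernelProb Y d y = c) :
    prob (jointLaw p) U u = prob p v a * c := by
  rw [prob_jointLaw, prob_eq_sum, Finset.sum_mul]
  refine Finset.sum_congr rfl fun d _ => ?_
  by_cases h : v d = a
  · rw [if_pos h, ← hc d h, kernelProb, kernelProb]
    simp [hU, h]
  · simp [kernelProb, hU, h]

theorem prob_jointLaw_fst {D R β : Type*} [Fintype D] [Fintype R] [Nonempty R] (p : PMF D)
    (v : D → β) (a : β) :
    prob (jointLaw (R := R) p) (fun ω => v ω.1) a = prob p v a := by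
  rw [prob_jointLaw_of_iff (c := 1) (a := a) (y := ()) p _ v (fun _ => ()) (by simp), mul_one]
  intro d _
  simp [kernelProb]

/-- If all conditional laws of `Y` coincide, then `Y` is independent of the data, and so of any
function `v` of the data. -/
theorem mutualInfo_jointLaw_eq_zero {D R α β : Type*} [Fintype D] [Fintype R] [Nonempty R]
    (p : PMF D) (v : D → α) (Y : D × R → β) (h : ∀ d d', Coupled Y d d') :
    mutualInfo (jointLaw p) (fun ω => v ω.1) Y = 0 := by
  refine mutualInfo_eq_zero_of_prob _ _ _ fun ω => ?_
  rw [prob_jointLaw_of_iff p _ v Y (a := v ω.1) (y := Y ω) (by simp)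
      fun d _ => (h d ω.1).kernelProb_eq (Y ω), prob_jointLaw_fst,
    prob_jointLaw_of_iff p Y (fun _ => ()) Y (a := ()) (by simp)
      fun d _ => (h d ω.1).kernelProb_eq (Y ω)]
  have : prob p (fun _ => ()) () = 1 := by simp [prob_eq_sum, PMF_sum_toReal]
  rw [this, one_mul]

theorem condMutualInfo_jointLaw_eq_zero {D R α β γ : Type*} [Fintype D] [Fintype R] [Nonempty R]
    (p : PMF D) (v : D → α) (x : D → γ) (Y : D × R → β)
    (h : ∀ d d', x d = x d' → Coupled Y d d') :
    condMutualInfo (jointLaw p) (fun ω => v ω.1) Y (fun ω => x ω.1) = 0 := by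
  refine condMutualInfo_eq_zero_of_prob _ _ _ _ fun ω => ?_
  have hk : ∀ d, x d = x ω.1 → kernelProb Y d (Y ω) = kernelProb Y ω.1 (Y ω) :=
    fun d hd => (h d ω.1 hd).kernelProb_eq _
  rw [prob_jointLaw_of_iff p _ (fun d => (v d, x d)) Y (a := (v ω.1, x ω.1)) (y := Y ω)
      (by intro ω'; simp only [Prod.mk.injEq]; tauto) fun d hd => hk d (Prod.ext_iff.1 hd).2,
    prob_jointLaw_of_iff p (fun ω => (Y ω, x ω.1)) x Y (a := x ω.1) (y := Y ω)
      (by intro ω'; simp only [Prod.mk.injEq]; tauto) hk,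
    prob_jointLaw_fst, prob_jointLaw_fst p fun d => (v d, x d)]
  ring

/-- The coupling makes `v`, `x`, `Y` a Markov chain: the kernel from the data to `Y` factors through
`x`. When `v` is independent of `x`, summing over the values of `x` makes it independent of `Y`. -/
theorem mutualInfo_jointLaw_eq_zero_of_factor {D R α β γ : Type*} [Fintype D] [Fintype R]
    [Nonempty R] (p : PMF D) (v : D → α) (x : D → γ) (Y : D × R → β)
    (h : ∀ d d', x d = x d' → Coupled Y d d')
    (hv : mutualInfo (jointLaw (R := R) p) (fun ω => v ω.1) (fun ω => x ω.1) = 0) :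
    mutualInfo (jointLaw p) (fun ω => v ω.1) Y = 0 := by
  have hind : ∀ a b, prob p (fun d => (v d, x d)) (a, b) = prob p v a * prob p x b := by
    intro a b
    have := prob_pair_of_mutualInfo_eq_zero _ _ _ hv a b
    rwa [prob_jointLaw_fst p fun d => (v d, x d), prob_jointLaw_fst, prob_jointLaw_fst] at this
  refine mutualInfo_eq_zero_of_prob _ _ _ fun ω => ?_
  set y := Y ω
  -- a kernel from the values of `x` to `Y`
  obtain ⟨κ, hκ⟩ : ∃ κ : γ → ℝ, ∀ d, kernelProb Y d y = κ (x d) :=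
    (Function.factorsThrough_iff (fun d => kernelProb Y d y)).1
      (fun d d' hd => (h d d' hd).kernelProb_eq y) |>.imp fun _ hκ d => congrFun hκ d
  have hY : prob (jointLaw p) Y y = ∑ b ∈ Finset.univ.image x, prob p x b * κ b := by
    rw [prob_jointLaw, sum_prob_mul]
    simp only [hκ]
  rw [prob_jointLaw_fst, hY]
  have hVY : prob (jointLaw p) (fun ω => (v ω.1, Y ω)) (v ω.1, y) =
      ∑ b ∈ Finset.univ.image x, prob p (fun d => (v d, x d)) (v ω.1, b) * κ b := by
    rw [prob_jointLaw]
    simp only [prob_eq_sum, Finset.sum_mul]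
    rw [Finset.sum_comm]
    refine Finset.sum_congr rfl fun d _ => ?_
    rw [Finset.sum_eq_single (x d)]
    · by_cases hd : v d = v ω.1
      · rw [if_pos (by rw [hd]), ← hκ, kernelProb, kernelProb]
        simp [hd]
      · rw [if_neg (by simp [hd]), kernelProb]
        simp [hd]
    · intro b _ hb
      rw [if_neg (by simp [Ne.symm hb]), zero_mul]
    · intro hn
      exact absurd (Finset.mem_image_of_mem x (Finset.mem_univ d)) hn
  rw [hVY, Finset.mul_sum]
  refine Finset.sum_congr rfl fun b _ => ?_
  rw [hind]
  ring

/-- If the law of `Y` given the data depends only on a statistic of `x`, and this statistic can be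
computed from `Y`, then `Y` carries exactly this statistic as information about `x`. -/
theorem mutualInfo_jointLaw_eq_entropy {D R β γ τ : Type*} [Fintype D] [Fintype R] [Nonempty R]
    (p : PMF D) (x : D → γ) (Y : D × R → β) (stat : γ → τ)
    (h : ∀ d d', stat (x d) = stat (x d') → Coupled Y d d')
    (hs : ∀ ω ω', Y ω = Y ω' → stat (x ω.1) = stat (x ω'.1)) :
    mutualInfo (jointLaw p) (fun ω => x ω.1) Y =
      entropy (jointLaw (R := R) p) (fun ω => stat (x ω.1)) := by
  refine mutualInfo_eq_of_prob _ _ _ _ fun ω => ?_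
  have hk : ∀ d, stat (x d) = stat (x ω.1) → kernelProb Y d (Y ω) = kernelProb Y ω.1 (Y ω) :=
    fun d hd => (h d ω.1 hd).kernelProb_eq _
  rw [prob_jointLaw_of_iff p _ x Y (a := x ω.1) (y := Y ω) (by simp)
      fun d hd => hk d (congrArg stat hd), prob_jointLaw_fst,
    prob_jointLaw_of_iff p Y (fun d => stat (x d)) Y (a := stat (x ω.1)) (y := Y ω)
      (fun ω' => ⟨fun h' => ⟨hs _ _ h', h'⟩, fun h' => h'.2⟩) hk,
    prob_jointLaw_fst p fun d => stat (x d)]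
  ring

end Finite

end PRUW
namespace PRUW

/-! ### Polynomial functions of the evaluation points -/

open Polynomial in
/-- The functions on a set of databases that are polynomials of degree at most `d` in the
evaluation points `α`. -/
def polyFun {F ι : Type*} [Field F] (α : ι → F) (d : ℕ) : Submodule F (ι → F) where
  carrier := {g | ∃ q : F[X], q.natDegree ≤ d ∧ ∀ n, g n = q.eval (α n)}
  zero_mem' := ⟨0, by simp⟩
  add_mem' := by
    rintro _ _ ⟨q, hq, h⟩ ⟨q', hq', h'⟩
    exact ⟨q + q', Polynomial.natDegree_add_le_of_degree_le hq hq', fun n => by simp [h, h']⟩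
  smul_mem' := by
    rintro c _ ⟨q, hq, h⟩
    exact ⟨Polynomial.C c * q, (Polynomial.natDegree_C_mul_le c q).trans hq,
      fun n => by simp [h]⟩

section polyFun

variable {F ι : Type*} [Field F] {α : ι → F} {d e : ℕ}

theorem polyFun_mono (h : d ≤ e) : polyFun α d ≤ polyFun α e := by
  rintro _ ⟨q, hq, h'⟩
  exact ⟨q, hq.trans h, h'⟩

theorem mul_mem_polyFun {g g' : ι → F} (h : g ∈ polyFun α d) (h' : g' ∈ polyFun α e) :
    (fun n => g n * g' n) ∈ polyFun α (d + e) := by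
  obtain ⟨q, hq, h⟩ := h
  obtain ⟨q', hq', h'⟩ := h'
  exact ⟨q * q', Polynomial.natDegree_mul_le_of_le hq hq', fun n => by simp [h, h']⟩

theorem const_mem_polyFun (c : F) : (fun _ => c) ∈ polyFun α d :=
  ⟨Polynomial.C c, by simp, by simp⟩

theorem pow_mem_polyFun {j : ℕ} (h : j ≤ d) : (fun n => α n ^ j) ∈ polyFun α d :=
  ⟨Polynomial.X ^ j, by simpa using h, by simp⟩

theorem sub_mem_polyFun (c : F) : (fun n => c - α n) ∈ polyFun α 1 :=
  ⟨Polynomial.C c - Polynomial.X, (Polynomial.natDegree_sub_le _ _).trans (by simp), by simp⟩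

theorem mul_const_mem_polyFun {g : ι → F} (h : g ∈ polyFun α d) (c : F) :
    (fun n => g n * c) ∈ polyFun α d :=
  mul_mem_polyFun h (const_mem_polyFun (d := 0) c)

theorem add_mem_polyFun {g g' : ι → F} (h : g ∈ polyFun α d) (h' : g' ∈ polyFun α d) :
    (fun n => g n + g' n) ∈ polyFun α d := (polyFun α d).add_mem h h'

theorem sum_mem_polyFun {κ : Type*} {s : Finset κ} {g : κ → ι → F}
    (h : ∀ k ∈ s, g k ∈ polyFun α d) : (fun n => ∑ k ∈ s, g k n) ∈ polyFun α d := by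
  have := (polyFun α d).sum_mem h
  rwa [show (fun n => ∑ k ∈ s, g k n) = ∑ k ∈ s, g k by ext n; simp]

theorem sum_pow_mul_mem_polyFun (z : Fin (d + 1) → F) :
    (fun n => ∑ j : Fin (d + 1), α n ^ (j : ℕ) * z j) ∈ polyFun α d :=
  sum_mem_polyFun fun j _ => mul_const_mem_polyFun (pow_mem_polyFun (Nat.lt_succ_iff.1 j.2)) _

/-- Interference has the shape of the storage noise; the coefficients are the same for all
databases, so they can be added to the noise symbols. -/
theorem exists_coeff_of_mem_polyFun {g : ι → F} (h : g ∈ polyFun α d) :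
    ∃ c : Fin (d + 1) → F, ∀ n, g n = ∑ j : Fin (d + 1), α n ^ (j : ℕ) * c j := by
  obtain ⟨q, hq, h⟩ := h
  refine ⟨fun j => q.coeff j, fun n => ?_⟩
  rw [h, Polynomial.eval_eq_sum_range' (Nat.lt_succ_of_le hq),
    Finset.sum_range fun i => q.coeff i * α n ^ i]
  exact Finset.sum_congr rfl fun j _ => mul_comm _ _

/-- `X - c` divides `q - q(c)`. Thus multiplying a polynomial by a simple pole at `c` keeps only its
value at `c` in the pole, and the rest is interference. -/
theorem inv_mul_sub_mem_polyFun (q : Polynomial F) (hq : q.natDegree ≤ d) (c : F)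
    (hc : ∀ n, c ≠ α n) :
    (fun n => (c - α n)⁻¹ * q.eval (α n) - (c - α n)⁻¹ * q.eval c) ∈ polyFun α d := by
  obtain ⟨q', hq'⟩ := Polynomial.dvd_iff_isRoot.2
    (show (q - Polynomial.C (q.eval c)).IsRoot c by simp [Polynomial.IsRoot])
  refine ⟨-q', ?_, fun n => ?_⟩
  · rw [Polynomial.natDegree_neg]
    by_cases h0 : q' = 0
    · simp [h0]
    have h1 : (q - Polynomial.C (q.eval c)).natDegree ≤ d := by simpa using hq
    rw [hq', Polynomial.natDegree_mul (Polynomial.X_sub_C_ne_zero c) h0] at h1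
    omega
  · have h1 := congrArg (Polynomial.eval (α n)) hq'
    simp only [Polynomial.eval_sub, Polynomial.eval_C, Polynomial.eval_mul,
      Polynomial.eval_X] at h1
    have h2 := sub_ne_zero.2 (hc n)
    simp only [← mul_sub, h1, Polynomial.eval_neg]
    field_simp
    ring

end polyFun

/-! ### Uncoded storage -/

section Uncoded

open Polynomial in
/-- The polynomial `∏ⱼ (f j - X)` over the indices in `s`. -/
noncomputable def nodeProd {F : Type*} [Field F] {ℓ : ℕ} (f : Fin ℓ → F) (s : Finset (Fin ℓ)) :
    F[X] := ∏ j ∈ s, (C (f j) - X)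

variable {F ι : Type*} [Field F] {ℓ e : ℕ} {f : Fin ℓ → F} {α : ι → F}

theorem eval_nodeProd (s : Finset (Fin ℓ)) (a : F) :
    (nodeProd f s).eval a = ∏ j ∈ s, (f j - a) := by
  simp [nodeProd, Polynomial.eval_prod]

theorem natDegree_nodeProd_le (s : Finset (Fin ℓ)) : (nodeProd f s).natDegree ≤ ℓ := by
  refine (Polynomial.natDegree_prod_le _ _).trans ((Finset.sum_le_card_nsmul _ _ 1 ?_).trans ?_)
  · exact fun j _ => (Polynomial.natDegree_sub_le _ _).trans (by simp)
  · simpa using s.card_le_univ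

theorem eval_nodeProd_erase {j k : Fin ℓ} (h : j ≠ k) :
    (nodeProd f (Finset.univ.erase j)).eval (f k) = 0 := by
  rw [eval_nodeProd]
  exact Finset.prod_eq_zero (Finset.mem_erase.2 ⟨h.symm, Finset.mem_univ k⟩) (sub_self _)

theorem eval_nodeProd_univ (k : Fin ℓ) : (nodeProd f Finset.univ).eval (f k) = 0 := by
  rw [eval_nodeProd]
  exact Finset.prod_eq_zero (Finset.mem_univ k) (sub_self _)

theorem eval_nodeProd_erase_self_ne_zero (hf : Function.Injective f) (k : Fin ℓ) :
    (nodeProd f (Finset.univ.erase k)).eval (f k) ≠ 0 := by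
  rw [eval_nodeProd, Finset.prod_ne_zero_iff]
  exact fun j hj => sub_ne_zero.2 (hf.ne (Finset.ne_of_mem_erase hj))

/-- The values of the updates are determined by the answers, up to polynomial interference. -/
theorem eq_zero_of_sum_inv_mul_mem_polyFun [Fintype ι] {d : ℕ} (hf : Function.Injective f)
    (hα : Function.Injective α) (hfα : ∀ k n, f k ≠ α n) (hd : d + ℓ < Fintype.card ι)
    {v : Fin ℓ → F} (h : (fun n => ∑ k, (f k - α n)⁻¹ * v k) ∈ polyFun α d) : v = 0 := by
  obtain ⟨q, hq, h⟩ := h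
  -- The difference of both sides with the denominators cleared by `∏ⱼ (f j - X)`; it vanishes at
  -- every `α n`, which is more points than its degree allows.
  set H : Polynomial F := ∑ k, Polynomial.C (v k) * nodeProd f (Finset.univ.erase k) -
    q * nodeProd f Finset.univ with hH
  have hdeg : H.natDegree ≤ d + ℓ := by
    refine Polynomial.natDegree_sub_le_of_le ?_ ?_
      |>.trans (max_le (le_refl _) (le_refl _))
    · refine Polynomial.natDegree_sum_le_of_forall_le _ _ fun k _ => ?_
      exact (Polynomial.natDegree_C_mul_le _ _).trans ((natDegree_nodeProd_le _).trans
        (Nat.le_add_left _ _))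
    · exact Polynomial.natDegree_mul_le_of_le hq (natDegree_nodeProd_le _)
  have hroot : ∀ n, H.eval (α n) = 0 := by
    intro n
    simp only [hH, Polynomial.eval_sub, Polynomial.eval_finsetSum, Polynomial.eval_mul,
      Polynomial.eval_C, ← h n, eval_nodeProd, Finset.sum_mul]
    rw [sub_eq_zero]
    refine Finset.sum_congr rfl fun k _ => ?_
    rw [← Finset.mul_prod_erase _ _ (Finset.mem_univ k)]
    have := sub_ne_zero.2 (hfα k n)
    field_simp
  have hH0 : H = 0 := Polynomial.eq_zero_of_natDegree_lt_card_of_eval_eq_zero H hα hroot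
    (hdeg.trans_lt hd)
  -- At the node `f k` every term of `H` except the `k`-th one contains the factor `f k - f k`.
  funext k
  have hk := congrArg (Polynomial.eval (f k)) hH0
  simp only [hH, Polynomial.eval_sub, Polynomial.eval_finsetSum, Polynomial.eval_mul,
    Polynomial.eval_C, eval_nodeProd_univ, mul_zero, sub_zero, Polynomial.eval_zero] at hk
  rw [Finset.sum_eq_single k (fun j _ hj => by rw [eval_nodeProd_erase hj, mul_zero])
    (by simp)] at hk
  exact (mul_eq_zero.1 hk).resolve_right (eval_nodeProd_erase_self_ne_zero hf k)

/-- The combined update is a Lagrange interpolation of `δ` at the nodes `f k`, plus noise times a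
polynomial vanishing at all the nodes. The noise therefore hides the update at `α n` without
changing the values at the nodes. -/
theorem exists_uncodedComb_eq_eval (hf : Function.Injective f) (δ : Fin ℓ → F) (z : F) :
    ∃ q : Polynomial F, q.natDegree ≤ ℓ ∧ (∀ a, uncodedComb f a δ z = q.eval a) ∧
      ∀ k, q.eval (f k) = δ k := by
  refine ⟨∑ k, nodeProd f (Finset.univ.erase k) *
    Polynomial.C (δ k / ∏ j ∈ Finset.univ.erase k, (f j - f k)) +
    nodeProd f Finset.univ * Polynomial.C z, ?_, fun a => ?_, fun k => ?_⟩
  · refine Polynomial.natDegree_add_le_of_degree_le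
      (Polynomial.natDegree_sum_le_of_forall_le _ _ fun k _ => ?_) ?_
    · exact (Polynomial.natDegree_mul_C_le _ _).trans (natDegree_nodeProd_le _)
    · exact (Polynomial.natDegree_mul_C_le _ _).trans (natDegree_nodeProd_le _)
  · simp [uncodedComb, Polynomial.eval_finsetSum, eval_nodeProd]
  · simp only [Polynomial.eval_add, Polynomial.eval_finsetSum, Polynomial.eval_mul,
      Polynomial.eval_C, eval_nodeProd_univ, zero_mul, add_zero]
    rw [Finset.sum_eq_single k (fun j _ hj => by rw [eval_nodeProd_erase hj, zero_mul])
      (by simp), ← eval_nodeProd]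
    exact mul_div_cancel₀ _ (eval_nodeProd_erase_self_ne_zero hf k)

theorem uncodedSymbol_sub_mem_polyFun {d : ℕ} (k : Fin ℓ) (w : F) (z : Fin (d + 1) → F) :
    (fun n => uncodedSymbol (f k) (α n) w z - (f k - α n)⁻¹ * w) ∈ polyFun α d := by
  simpa [uncodedSymbol] using sum_pow_mul_mem_polyFun z

variable {T : Type*} [Fintype T] [DecidableEq T] {τ : T ≃ T}
  {A : ι → T × Fin ℓ → T × Fin ℓ → F}

/-- The answer of a database with uncoded storage is the desired subpacket, up to polynomial
interference. -/
theorem uncoded_answer_sub_mem_polyFun {d : ℕ} (hfα : ∀ k n, f k ≠ α n)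
    (hA : ∀ a b, (fun n => A n a b -
      if a.1 = τ b.1 ∧ a.2 = b.2 then (f a.2 - α n)⁻¹ else 0) ∈ polyFun α e)
    {S : ι → T → Fin ℓ → F} {w : T → Fin ℓ → F}
    (hS : ∀ s k, (fun n => S n s k - (f k - α n)⁻¹ * w s k) ∈ polyFun α d) (t : T) :
    (fun n => ∑ s, ∑ k, ((f k - α n) * S n s k) * ∑ h, A n (s, k) (t, h) -
      ∑ k, (f k - α n)⁻¹ * w (τ t) k) ∈ polyFun α (d + 1 + e) := by
  -- Of the `ℓ` summed columns only `h = k` contributes a pole in row `(s, k)`.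
  have hrow : ∀ s k, (fun n => ∑ h, A n (s, k) (t, h) - if s = τ t then (f k - α n)⁻¹ else 0) ∈
      polyFun α e := by
    intro s k
    have := sum_mem_polyFun (s := Finset.univ) fun h _ => hA (s, k) (t, h)
    convert this using 2 with n
    rw [Finset.sum_sub_distrib]
    by_cases hs : s = τ t <;> simp [hs]
  -- The rescaling clears the pole of the storage, so that its product with the interference of the
  -- matrix is again a polynomial.
  have hD : ∀ s k, (fun n => (f k - α n) * S n s k) ∈ polyFun α (d + 1) := by
    intro s k
    have := add_mem_polyFun (mul_mem_polyFun (hS s k) (sub_mem_polyFun (f k)))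
      (const_mem_polyFun (w s k))
    convert this using 2 with n
    have := sub_ne_zero.2 (hfα k n)
    field_simp
    ring
  have hterm : ∀ s k, (fun n => ((f k - α n) * S n s k) * ∑ h, A n (s, k) (t, h) -
      if s = τ t then (f k - α n)⁻¹ * w s k else 0) ∈ polyFun α (d + 1 + e) := by
    intro s k
    have h1 := mul_mem_polyFun (hD s k) (hrow s k)
    by_cases hs : s = τ t
    · simp only [hs, if_true] at h1 ⊢
      -- With `c = f k - α n` and `ρ` the row sum, `c S ρ - w / c = c S (ρ - 1 / c) + (S - w / c)`,
      -- and both summands are interference.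
      have := add_mem_polyFun h1 (polyFun_mono (by omega : d ≤ d + 1 + e) (hS (τ t) k))
      convert this using 2 with n
      have := sub_ne_zero.2 (hfα k n)
      field_simp
      ring
    · simpa [hs] using h1
  have := sum_mem_polyFun (s := Finset.univ) fun s _ =>
    sum_mem_polyFun (s := Finset.univ) fun k _ => hterm s k
  convert this using 2 with n
  simp only [Finset.sum_sub_distrib]
  congr 1
  rw [Finset.sum_comm]
  simp

/-- The increment of the uncoded storage is the update, up to polynomial interference. -/
theorem uncoded_update_sub_mem_polyFun (hf : Function.Injective f) (hfα : ∀ k n, f k ≠ α n)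
    (hA : ∀ a b, (fun n => A n a b -
      if a.1 = τ b.1 ∧ a.2 = b.2 then (f a.2 - α n)⁻¹ else 0) ∈ polyFun α e)
    (Δ : T → Fin ℓ → F) (u : T → F) (s : T) (k : Fin ℓ) :
    (fun n => ∑ b : T × Fin ℓ, A n (s, k) b * uncodedComb f (α n) (Δ (τ b.1)) (u b.1) -
      (f k - α n)⁻¹ * Δ s k) ∈ polyFun α (ℓ + e) := by
  have hterm : ∀ b : T × Fin ℓ, (fun n =>
      A n (s, k) b * uncodedComb f (α n) (Δ (τ b.1)) (u b.1) -
      if s = τ b.1 ∧ k = b.2 then (f k - α n)⁻¹ * Δ s k else 0) ∈ polyFun α (ℓ + e) := by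
    intro b
    obtain ⟨q, hq, hqe, hqk⟩ := exists_uncodedComb_eq_eval hf (Δ (τ b.1)) (u b.1)
    simp only [hqe]
    have h1 := mul_mem_polyFun (α := α) ⟨q, hq, fun n => rfl⟩ (hA (s, k) b)
    by_cases hs : s = τ b.1 ∧ k = b.2
    · have := add_mem_polyFun h1 (polyFun_mono (by omega : ℓ ≤ ℓ + e)
        (inv_mul_sub_mem_polyFun q hq (f k) (hfα k)))
      convert this using 2 with n
      simp only [hs, and_self, if_true, hqk]
      ring
    · simp only [hs, if_false, sub_zero] at h1 ⊢
      simpa only [mul_comm] using h1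
  have := sum_mem_polyFun (s := Finset.univ) fun b _ => hterm b
  convert this using 2 with n
  rw [Finset.sum_sub_distrib]
  congr 1
  rw [Finset.sum_eq_single (τ.symm s, k)]
  · simp
  · rintro ⟨t, h⟩ - hb
    refine if_neg ?_
    rintro ⟨rfl, rfl⟩
    simp at hb
  · simp

end Uncoded

/-! ### MDS coded storage -/

section Coded

variable {F ι : Type*} [Field F] {ℓ e : ℕ} {α : ι → F}

/-- The values of the updates are determined by the answers, up to polynomial interference. -/
theorem eq_zero_of_sum_pow_inv_mul_mem_polyFun [Fintype ι] {d : ℕ} (hα : Function.Injective α)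
    (hα0 : ∀ n, α n ≠ 0) (hd : d + ℓ < Fintype.card ι) {v : Fin ℓ → F}
    (h : (fun n => ∑ i : Fin ℓ, (α n ^ ((i : ℕ) + 1))⁻¹ * v i) ∈ polyFun α d) : v = 0 := by
  obtain ⟨q, hq, h⟩ := h
  -- The difference of both sides multiplied by `X ^ ℓ`. As `i < ℓ`, the truncated exponent `ℓ - 1 -
  -- i` is the true difference.
  set H : Polynomial F := ∑ i : Fin ℓ, Polynomial.C (v i) * Polynomial.X ^ (ℓ - 1 - (i : ℕ)) -
    q * Polynomial.X ^ ℓ with hH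
  have hdeg : H.natDegree ≤ d + ℓ := by
    refine Polynomial.natDegree_sub_le_of_le ?_ ?_
      |>.trans (max_le (le_refl _) (le_refl _))
    · refine Polynomial.natDegree_sum_le_of_forall_le _ _ fun k _ => ?_
      exact (Polynomial.natDegree_C_mul_le _ _).trans (by rw [Polynomial.natDegree_X_pow]; omega)
    · exact Polynomial.natDegree_mul_le_of_le hq (by simp)
  have hroot : ∀ n, H.eval (α n) = 0 := by
    intro n
    simp only [hH, Polynomial.eval_sub, Polynomial.eval_finsetSum, Polynomial.eval_mul,
      Polynomial.eval_C, ← h n, Finset.sum_mul, Polynomial.eval_pow, Polynomial.eval_X]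
    rw [sub_eq_zero]
    refine Finset.sum_congr rfl fun i _ => ?_
    have : α n ^ ℓ = α n ^ ((i : ℕ) + 1) * α n ^ (ℓ - 1 - (i : ℕ)) := by
      rw [← pow_add]
      congr 1
      omega
    rw [this]
    have := pow_ne_zero ((i : ℕ) + 1) (hα0 n)
    field_simp
  have hH0 : H = 0 := Polynomial.eq_zero_of_natDegree_lt_card_of_eval_eq_zero H hα hroot
    (hdeg.trans_lt hd)
  funext i
  -- The values occupy the coefficients below `X ^ ℓ`, where `q * X ^ ℓ` contributes nothing.
  have hi := congrArg (fun p => Polynomial.coeff p (ℓ - 1 - (i : ℕ))) hH0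
  simp only [hH, Polynomial.coeff_sub, Polynomial.finsetSum_coeff, Polynomial.coeff_C_mul,
    Polynomial.coeff_X_pow, Polynomial.coeff_mul_X_pow' q, Polynomial.coeff_zero] at hi
  rw [if_neg (by omega), sub_zero, Finset.sum_eq_single i] at hi
  · simpa using hi
  · intro j _ hj
    rw [if_neg, mul_zero]
    intro h
    exact hj (Fin.ext (by omega))
  · simp

theorem pow_mul_sum_pow_inv_mem_polyFun (hα0 : ∀ n, α n ≠ 0) (v : Fin ℓ → F) :
    (fun n => α n ^ ℓ * ∑ i : Fin ℓ, (α n ^ ((i : ℕ) + 1))⁻¹ * v i) ∈ polyFun α ℓ := by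
  have := sum_mem_polyFun (α := α) (d := ℓ) (s := Finset.univ) fun (i : Fin ℓ) _ =>
    mul_const_mem_polyFun (pow_mem_polyFun (by omega : ℓ - 1 - (i : ℕ) ≤ ℓ)) (v i)
  convert this using 2 with n
  rw [Finset.mul_sum]
  refine Finset.sum_congr rfl fun i _ => ?_
  have : α n ^ ℓ = α n ^ ((i : ℕ) + 1) * α n ^ (ℓ - 1 - (i : ℕ)) := by
    rw [← pow_add]
    congr 1
    omega
  rw [this]
  have := pow_ne_zero ((i : ℕ) + 1) (hα0 n)
  field_simp

theorem codedSymbol_sub_mem_polyFun {d : ℕ} (w : Fin ℓ → F) (z : Fin (d + 1) → F) :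
    (fun n => codedSymbol (α n) w z - ∑ i : Fin ℓ, (α n ^ ((i : ℕ) + 1))⁻¹ * w i) ∈
      polyFun α d := by
  simpa [codedSymbol] using sum_pow_mul_mem_polyFun z

/-- The factor `α ^ ℓ` in front of the noise of a coded reversing matrix clears all the poles of a
coded symbol; this is why that noise causes only polynomial interference. -/
theorem pow_mul_mem_polyFun_of_sub_mem {d : ℕ} (hα0 : ∀ n, α n ≠ 0) {g : ι → F}
    {v : Fin ℓ → F}
    (h : (fun n => g n - ∑ i : Fin ℓ, (α n ^ ((i : ℕ) + 1))⁻¹ * v i) ∈ polyFun α d) :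
    (fun n => α n ^ ℓ * g n) ∈ polyFun α (ℓ + d) := by
  have := add_mem_polyFun (mul_mem_polyFun (pow_mem_polyFun (le_refl ℓ)) h)
    (polyFun_mono (by omega : ℓ ≤ ℓ + d) (pow_mul_sum_pow_inv_mem_polyFun hα0 v))
  convert this using 2 with n
  ring

variable {T : Type*} [Fintype T] [DecidableEq T] {τ : T ≃ T} {A : ι → T → T → F}

/-- The answer of a database with coded storage is the desired subpacket, up to polynomial
interference. -/
theorem coded_answer_sub_mem_polyFun {d : ℕ} (hα0 : ∀ n, α n ≠ 0)
    (hA : ∀ s t, ∃ c ∈ polyFun α e, ∀ n, A n s t = (if s = τ t then 1 else 0) + α n ^ ℓ * c n)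
    {S : ι → T → F} {w : T → Fin ℓ → F}
    (hS : ∀ s, (fun n => S n s - ∑ i : Fin ℓ, (α n ^ ((i : ℕ) + 1))⁻¹ * w s i) ∈ polyFun α d)
    (t : T) :
    (fun n => ∑ s, S n s * A n s t - ∑ i : Fin ℓ, (α n ^ ((i : ℕ) + 1))⁻¹ * w (τ t) i) ∈
      polyFun α (ℓ + d + e) := by
  have hterm : ∀ s, (fun n => S n s * A n s t -
      if s = τ t then ∑ i : Fin ℓ, (α n ^ ((i : ℕ) + 1))⁻¹ * w s i else 0) ∈
      polyFun α (ℓ + d + e) := by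
    intro s
    obtain ⟨c, hc, hAc⟩ := hA s t
    have h1 := mul_mem_polyFun (pow_mul_mem_polyFun_of_sub_mem hα0 (hS s)) hc
    by_cases hs : s = τ t
    · have := add_mem_polyFun h1 (polyFun_mono (by omega : d ≤ ℓ + d + e) (hS s))
      convert this using 2 with n
      rw [hAc, if_pos hs, if_pos hs]
      ring
    · convert h1 using 2 with n
      rw [hAc, if_neg hs, if_neg hs]
      ring
  have := sum_mem_polyFun (s := Finset.univ) fun s _ => hterm s
  convert this using 2 with n
  rw [Finset.sum_sub_distrib]
  simp

/-- The increment of the coded storage is the update, up to polynomial interference. -/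
theorem coded_update_sub_mem_polyFun (hα0 : ∀ n, α n ≠ 0)
    (hA : ∀ s t, ∃ c ∈ polyFun α e, ∀ n, A n s t = (if s = τ t then 1 else 0) + α n ^ ℓ * c n)
    (Δ : T → Fin ℓ → F) (u : T → F) (s : T) :
    (fun n => ∑ t, A n s t * codedComb (α n) (Δ (τ t)) (u t) -
      ∑ i : Fin ℓ, (α n ^ ((i : ℕ) + 1))⁻¹ * Δ s i) ∈ polyFun α (ℓ + e) := by
  have hterm : ∀ t, (fun n => A n s t * codedComb (α n) (Δ (τ t)) (u t) -
      if s = τ t then ∑ i : Fin ℓ, (α n ^ ((i : ℕ) + 1))⁻¹ * Δ s i else 0) ∈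
      polyFun α (ℓ + e) := by
    intro t
    obtain ⟨c, hc, hAc⟩ := hA s t
    -- A coded update is a coded symbol with interference of degree 0, so the computation for the
    -- answers applies with `d = 0`.
    have h0 : (fun n => codedComb (α n) (Δ (τ t)) (u t) -
        ∑ i : Fin ℓ, (α n ^ ((i : ℕ) + 1))⁻¹ * Δ (τ t) i) ∈ polyFun α 0 := by
      simpa [codedComb] using const_mem_polyFun (u t)
    have h1 := mul_mem_polyFun (pow_mul_mem_polyFun_of_sub_mem hα0 h0) hc
    rw [add_zero] at h1
    by_cases hs : s = τ t
    · have := add_mem_polyFun h1 (polyFun_mono (by omega : 0 ≤ ℓ + e) h0)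
      convert this using 2 with n
      rw [hAc, if_pos hs, if_pos hs, hs]
      ring
    · convert h1 using 2 with n
      rw [hAc, if_neg hs, if_neg hs]
      ring
  have := sum_mem_polyFun (s := Finset.univ) fun t _ => hterm t
  convert this using 2 with n
  rw [Finset.sum_sub_distrib]
  congr 1
  rw [Finset.sum_eq_single (τ.symm s)]
  · simp
  · intro t _ ht
    refine if_neg ?_
    rintro rfl
    simp at ht
  · simp

end Coded

end PRUW
namespace PRUW

/-! ### Positions and permutations -/

section Positions

variable {B m K : ℕ}

theorem Positions.nth_injective (x : Positions B m K) : Function.Injective x.nth := fun _ _ h =>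
  (Finset.orderEmbOfFin _ _).injective (finProdFinEquiv.symm.injective h)

theorem Positions.mem_iff_exists_nth (x : Positions B m K) (s : Sub B m) :
    s ∈ x.1 ↔ ∃ i, x.nth i = s := by
  have h := Finset.range_orderEmbOfFin (x.1.map finProdFinEquiv.toEmbedding)
    ((Finset.card_map _).trans x.2)
  have h' := Set.ext_iff.1 h (finProdFinEquiv s)
  simp only [Set.mem_range, Finset.coe_map, Equiv.coe_toEmbedding, Set.mem_image,
    Finset.mem_coe, EmbeddingLike.apply_eq_iff_eq, exists_eq_right] at h'
  rw [← h']
  simp only [Positions.nth, Equiv.symm_apply_eq]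

theorem Positions.ext_nth {x x' : Positions B m K} (h : ∀ i, x.nth i = x'.nth i) : x = x' := by
  ext s
  simp only [Positions.mem_iff_exists_nth, h]

theorem Positions.mem_permuted (σ : Equiv.Perm (Sub B m)) (x : Positions B m K) (s : Sub B m) :
    s ∈ (x.permuted σ).1 ↔ σ s ∈ x.1 := by
  simp [Positions.permuted, Finset.mem_map_equiv]

/-- A permutation that maps whole segments to segments only relabels the counts. So the counts
survive within-segment permutations and their multiset survives all two-stage permutations. -/
theorem segCounts_permuted (τ : Equiv.Perm (Sub B m)) (σ : Equiv.Perm (Fin B))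
    (h : ∀ s, (τ s).1 = σ s.1) (x : Positions B m K) :
    segCounts (x.permuted τ) = segCounts x ∘ σ := by
  funext j
  simp only [segCounts, Positions.permuted, Finset.filter_map, Finset.card_map,
    Function.comp_apply]
  congr 1
  refine Finset.filter_congr fun s _ => ?_
  have := h (τ.symm s)
  rw [Equiv.apply_symm_apply] at this
  simp [this]

theorem segCounts_permuted_withinIdx (π : Fin B → Equiv.Perm (Fin m)) (x : Positions B m K) :
    segCounts (x.permuted (withinIdx π)) = segCounts x :=
  segCounts_permuted _ 1 (fun _ => rfl) x

theorem unorderedCounts_permuted_twoStageIdx (π : Fin B → Equiv.Perm (Fin m))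
    (σ : Equiv.Perm (Fin B)) (x : Positions B m K) :
    unorderedCounts (x.permuted (twoStageIdx π σ)) = unorderedCounts x := by
  rw [unorderedCounts, segCounts_permuted _ σ (fun _ => rfl), ← Multiset.map_map,
    Multiset.map_univ_val_equiv, unorderedCounts]

/-- Bijections between corresponding fibers are glued to a permutation. It is used both for
indicator functions of sets and for the counts of the segments. -/
theorem exists_perm_of_card_fiber_eq {α β : Type*} [Fintype α] [DecidableEq β] (g g' : α → β)
    (h : ∀ c, (Finset.univ.filter fun a => g a = c).card =
      (Finset.univ.filter fun a => g' a = c).card) :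
    ∃ σ : Equiv.Perm α, ∀ a, g' (σ a) = g a := by
  have e : ∀ c, Nonempty ({a // g a = c} ≃ {a // g' a = c}) := fun c => by
    rw [← Fintype.card_eq, Fintype.card_subtype, Fintype.card_subtype, h]
  exact ⟨Equiv.ofFiberEquiv fun c => (e c).some, fun a => Equiv.ofFiberEquiv_map _ a⟩

theorem exists_perm_mem_iff {α : Type*} [Fintype α] [DecidableEq α] (s t : Finset α)
    (h : s.card = t.card) : ∃ σ : Equiv.Perm α, ∀ a, σ a ∈ t ↔ a ∈ s := by
  obtain ⟨σ, hσ⟩ := exists_perm_of_card_fiber_eq (fun a => decide (a ∈ s))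
    (fun a => decide (a ∈ t)) (by
      rintro (_ | _)
      · simp [Finset.filter_not, Finset.card_univ_sdiff, h]
      · simpa using h)
  exact ⟨σ, fun a => by simpa using hσ a⟩

/-- Segment `j` of `x` and segment `σ j` of `x'` hold equally many positions, so some permutation of
`Fin m` matches them; the segments are treated independently. -/
theorem exists_within_perm (x x' : Positions B m K) (σ : Equiv.Perm (Fin B))
    (h : ∀ j, segCounts x' (σ j) = segCounts x j) :
    ∃ π : Fin B → Equiv.Perm (Fin m), ∀ j t, (σ j, π j t) ∈ x'.1 ↔ (j, t) ∈ x.1 := by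
  have hc : ∀ (y : Positions B m K) j,
      segCounts y j = (Finset.univ.filter fun t => (j, t) ∈ y.1).card := by
    intro y j
    rw [segCounts, ← Finset.card_map (Function.Embedding.sectR j (Fin m))]
    congr 1
    ext ⟨i, t⟩
    simp only [Finset.mem_filter, Finset.mem_map, Finset.mem_univ, true_and,
      Function.Embedding.sectR_apply, Prod.mk.injEq]
    constructor
    · rintro ⟨h1, rfl⟩
      exact ⟨t, h1, rfl, rfl⟩
    · rintro ⟨t', h1, rfl, rfl⟩
      exact ⟨h1, rfl⟩
  have hπ : ∀ j, ∃ π : Equiv.Perm (Fin m), ∀ t, (σ j, π t) ∈ x'.1 ↔ (j, t) ∈ x.1 := by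
    intro j
    obtain ⟨π, hπ⟩ := exists_perm_mem_iff (Finset.univ.filter fun t => (j, t) ∈ x.1)
      (Finset.univ.filter fun t => (σ j, t) ∈ x'.1) (by rw [← hc, ← hc, h])
    exact ⟨π, fun t => by simpa using hπ t⟩
  choose π hπ using hπ
  exact ⟨π, hπ⟩

/-- The within-segment permutations act transitively on the positions with given numbers in the
segments. -/
theorem exists_withinIdx_equiv {x x' : Positions B m K} (h : segCounts x = segCounts x') :
    ∃ e : (Fin B → Equiv.Perm (Fin m)) ≃ (Fin B → Equiv.Perm (Fin m)),
      ∀ π, x.permuted (withinIdx π) = x'.permuted (withinIdx (e π)) := by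
  obtain ⟨π₀, h₀⟩ := exists_within_perm x x' 1 fun j => by rw [h]; rfl
  -- Translation by one matching permutation: `π₀ j * π j` undoes to `x'` exactly when `π j` undoes
  -- to `x`.
  refine ⟨Equiv.mulLeft π₀, fun π => ?_⟩
  ext ⟨j, t⟩
  rw [Positions.mem_permuted, Positions.mem_permuted]
  exact (h₀ j (π j t)).symm

/-- The within- and inter-segment permutations act transitively on the positions with given
numbers in the segments, irrespective of the order of the segments. -/
theorem exists_twoStageIdx_equiv {x x' : Positions B m K}
    (h : unorderedCounts x = unorderedCounts x') :
    ∃ e : ((Fin B → Equiv.Perm (Fin m)) × Equiv.Perm (Fin B)) ≃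
        ((Fin B → Equiv.Perm (Fin m)) × Equiv.Perm (Fin B)),
      ∀ κ, x.permuted (twoStageIdx κ.1 κ.2) =
        x'.permuted (twoStageIdx (e κ).1 (e κ).2) := by
  obtain ⟨σ₀, hσ⟩ := exists_perm_of_card_fiber_eq (segCounts x) (segCounts x') (by
    intro c
    have := congrArg (Multiset.count c) h
    simp only [unorderedCounts, Multiset.count_map] at this
    simpa [Finset.card, eq_comm] using this)
  obtain ⟨π₀, h₀⟩ := exists_within_perm x x' σ₀ hσ
  -- The new key has inter-segment part `σ₀ * σ` and, in segment `σ₀ j`, the within-segment part `π₀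
  -- j * π j`; the reindexing by `σ₀` is needed because within-segment permutations are labelled by
  -- real segments.
  refine ⟨((Equiv.mulLeft π₀).trans (Equiv.arrowCongr σ₀ (Equiv.refl _))).prodCongr
    (Equiv.mulLeft σ₀), fun κ => ?_⟩
  ext ⟨j, t⟩
  rw [Positions.mem_permuted, Positions.mem_permuted]
  simpa [twoStageIdx] using (h₀ (κ.2 j) (κ.1 (κ.2 j) t)).symm

theorem sparseUpdate_eq_zero {F : Type*} [Field F] {ℓ : ℕ} {x : Positions B m K}
    {s : Sub B m} (h : s ∉ x.1) (δ : Values F ℓ K) : sparseUpdate x δ s = 0 := by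
  funext k
  exact Finset.sum_eq_zero fun i _ => if_neg fun hi => h ((x.mem_iff_exists_nth s).2 ⟨i, hi⟩)

/-- The vector built by a database combines the permuted sparse update with noise. -/
theorem updateVector_tuples {F : Type*} [Field F] {ℓ : ℕ} {comb : (Fin ℓ → F) → F → F}
    (hcomb : comb 0 0 = 0) (σ : Equiv.Perm (Sub B m)) (u : Fin K → F) (x : Positions B m K)
    (δ : Values F ℓ K) (s : Sub B m) :
    updateVector (tuples comb σ u x δ) s = comb (sparseUpdate x δ (σ s))
      (∑ i, if (x.permuted σ).nth i = s then u i else 0) := by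
  rw [updateVector]
  by_cases h : s ∈ (x.permuted σ).1
  · obtain ⟨i, rfl⟩ := ((x.permuted σ).mem_iff_exists_nth s).1 h
    simp [tuples, (Positions.nth_injective _).eq_iff]
  -- Off the updated positions the database has the entry 0; `hcomb` makes this a combined update as
  -- well, with zero update and zero noise.
  · have h' : ∀ i, (x.permuted σ).nth i ≠ s := fun i hi =>
      h (((x.permuted σ).mem_iff_exists_nth s).2 ⟨i, hi⟩)
    rw [Positions.mem_permuted] at h
    simp [tuples, h', sparseUpdate_eq_zero h, hcomb]

end Positions

end PRUW
namespace PRUW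

/-! ### Security and privacy from couplings of the randomness -/

/-- Equal permuted sets give equal lists of indices, and then a translation of the user's noise,
entry by entry, turns one list of updates into the other. -/
theorem tuples_coupled {F : Type u} [Field F] {B m ℓ K : ℕ} {comb : (Fin ℓ → F) → F → F}
    (hcomb : ∀ δ δ', ∃ c, ∀ z, comb δ z = comb δ' (z + c)) {σ σ' : Equiv.Perm (Sub B m)}
    {x x' : Positions B m K} (h : x.permuted σ = x'.permuted σ') (δ δ' : Values F ℓ K) :
    ∃ e : (Fin K → F) ≃ (Fin K → F), ∀ u, tuples comb σ u x δ = tuples comb σ' (e u) x' δ' := by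
  choose c hc using hcomb
  refine ⟨Equiv.addRight fun i => c (sparseUpdate x δ (σ ((x.permuted σ).nth i)))
    (sparseUpdate x' δ' (σ' ((x.permuted σ).nth i))), fun u => ?_⟩
  funext i
  simp only [tuples, ← h, Equiv.coe_addRight, Pi.add_apply]
  rw [← hc]

/-- The second components list the permuted set, so a message reveals it. -/
theorem permuted_eq_of_tuples_eq {F : Type u} [Field F] {B m ℓ K : ℕ}
    {comb comb' : (Fin ℓ → F) → F → F} {σ σ' : Equiv.Perm (Sub B m)} {u u' : Fin K → F}
    {x x' : Positions B m K} {δ δ' : Values F ℓ K}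
    (h : tuples comb σ u x δ = tuples comb' σ' u' x' δ') : x.permuted σ = x'.permuted σ' :=
  Positions.ext_nth fun i => congrArg Prod.snd (congrFun h i)

namespace Scheme

variable {F : Type u} {N B m ℓ Ku Kd : ℕ} (S : Scheme F N B m ℓ Ku Kd)

/-- The noise hides the model and the key in the content of each database. -/
def StorePadded : Prop :=
  ∀ n w k w' k', ∃ e : S.Noise ≃ S.Noise, ∀ z, S.store n w k z = S.store n w' k' (e z)

/-- The writing phase is correct, and permutes the noise. -/
def WritePadded [Field F] : Prop :=
  ∀ w k u x δ, ∃ e : S.Noise ≃ S.Noise, ∀ z n,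
    S.update n (S.store n w k z) (S.upload n k u x δ) =
      S.store n (w + sparseUpdate x δ) k (e z)

/-- The noise of the user hides everything but the permuted positions in the uploads. -/
def UploadPadded : Prop :=
  ∀ n k k' x x' δ δ', Positions.permuted (S.realIdx k) x = Positions.permuted (S.realIdx k') x' →
    ∃ e : S.UserNoise ≃ S.UserNoise, ∀ u, S.upload n k u x δ = S.upload n k' (e u) x' δ'

/-- The key hides everything but the statistic `stat` of the positions. -/
def KeyPadded {T : Type*} (stat : Positions B m Ku → T) : Prop :=
  ∀ x x', stat x = stat x' → ∃ e : S.Key ≃ S.Key, ∀ k,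
    x.permuted (S.realIdx k) = x'.permuted (S.realIdx (e k))

/-- Each upload reveals the statistic `stat` of the positions. -/
def UploadReveals {T : Type*} (stat : Positions B m Ku → T) : Prop :=
  ∀ n k k' u u' x x' δ δ', S.upload n k u x δ = S.upload n k' u' x' δ' → stat x = stat x'

variable {S}

theorem WritePadded.writeCorrect [Field F] (h : S.WritePadded) : S.WriteCorrect := by
  intro w k z u x δ
  obtain ⟨e, he⟩ := h w k u x δ
  exact ⟨e z, he z⟩

theorem coupled_storeBefore (hs : S.StorePadded) (n : Fin N) (d d' : Data F B m ℓ Ku) :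
    Coupled (S.storeBefore n) d d' := by
  choose E hE using hs
  refine ⟨Equiv.prodShear (Equiv.refl _)
    fun k => (E n d.1 k d'.1 k).prodCongr (Equiv.refl _), ?_⟩
  rintro ⟨k, z, u⟩
  exact hE n d.1 k d'.1 k z

theorem coupled_storeAfter [Field F] (hs : S.StorePadded) (hw : S.WritePadded) (n : Fin N)
    (d d' : Data F B m ℓ Ku) : Coupled (S.storeAfter n) d d' := by
  choose E hE using hs
  choose E' hE' using hw
  -- The storage after the round is an initial storage with noise moved by `E'`. The coupling goes
  -- forward along writing for `d`, across by `E`, and back along writing for `d'`, with key and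
  -- user noise fixed.
  let e : S.Key → S.UserNoise → (S.Noise ≃ S.Noise) := fun k u =>
    ((E' d.1 k u d.2.1 d.2.2).trans
      (E n (d.1 + sparseUpdate d.2.1 d.2.2) k (d'.1 + sparseUpdate d'.2.1 d'.2.2) k)).trans
      (E' d'.1 k u d'.2.1 d'.2.2).symm
  refine ⟨⟨fun ρ => (ρ.1, e ρ.1 ρ.2.2 ρ.2.1, ρ.2.2),
    fun ρ => (ρ.1, (e ρ.1 ρ.2.2).symm ρ.2.1, ρ.2.2), fun ρ => by simp, fun ρ => by simp⟩, ?_⟩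
  rintro ⟨k, z, u⟩
  change S.update n (S.store n d.1 k z) (S.upload n k u d.2.1 d.2.2) =
    S.update n (S.store n d'.1 k (e k u z)) (S.upload n k u d'.2.1 d'.2.2)
  rw [hE', hE', hE n _ k (d'.1 + sparseUpdate d'.2.1 d'.2.2) k]
  simp [e]

/-- The key is moved first, so that the permuted positions agree. Then storage noise and user noise,
which are independent, are moved by bijections that depend on the key. -/
theorem coupled_store_sent (hs : S.StorePadded) (hu : S.UploadPadded) {T : Type*}
    {stat : Positions B m Ku → T} (hk : S.KeyPadded stat) (n : Fin N)
    (d d' : Data F B m ℓ Ku) (h : stat d.2.1 = stat d'.2.1) :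
    Coupled (fun ω => (S.storeBefore n ω, S.sent n ω)) d d' := by
  choose E hE using hs
  obtain ⟨e, he⟩ := hk _ _ h
  have hu' := fun k => hu n k (e k) d.2.1 d'.2.1 d.2.2 d'.2.2 (he k)
  choose U hU using hu'
  refine ⟨Equiv.prodShear e fun k => (E n d.1 k d'.1 (e k)).prodCongr (U k), ?_⟩
  rintro ⟨k, z, u⟩
  exact Prod.ext (hE n d.1 k d'.1 (e k) z) (hU k u)

/-- `Scheme.law` unfolds to `jointLaw` with the triple of key, noise and user noise as the uniform
randomness, so the statements about couplings apply directly. -/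
theorem secure_of_padded [Field F] [Fintype F] (hs : S.StorePadded) (hw : S.WritePadded) :
    S.Secure := fun p n =>
  ⟨mutualInfo_jointLaw_eq_zero p (fun d => d.1) _ (coupled_storeBefore hs n),
    mutualInfo_jointLaw_eq_zero p (fun d => d.1 + sparseUpdate d.2.1 d.2.2) _
      (coupled_storeAfter hs hw n)⟩

theorem valuesPrivate_of_padded [Fintype F] (hs : S.StorePadded) (hu : S.UploadPadded)
    {T : Type*} {stat : Positions B m Ku → T} (hk : S.KeyPadded stat) : S.ValuesPrivate := by
  have hc : ∀ n (d d' : Data F B m ℓ Ku), d.2.1 = d'.2.1 →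
      Coupled (fun ω => (S.storeBefore n ω, S.sent n ω)) d d' := fun n d d' h =>
    coupled_store_sent hs hu hk n d d' (congrArg stat h)
  intro p n
  exact ⟨condMutualInfo_jointLaw_eq_zero p (fun d => d.2.2) (fun d => d.2.1) _ (hc n),
    fun T φ hφ => mutualInfo_jointLaw_eq_zero_of_factor p (fun d => φ d.2.2) (fun d => d.2.1) _
      (fun d d' h => (hc n d d' h).comp Prod.snd) hφ⟩

/-- The coupling bounds the leakage by the entropy of `stat`, and the upload alone already attains
it; the storage adds nothing. -/
theorem positionLeakage_of_padded [Fintype F] (hs : S.StorePadded) (hu : S.UploadPadded)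
    {T : Type*} {stat : Positions B m Ku → T} (hk : S.KeyPadded stat)
    (hr : S.UploadReveals stat) : S.PositionLeakage stat := by
  intro p n
  have hc := coupled_store_sent hs hu hk n
  have hr' : ∀ ω ω' : S.Sample, S.sent n ω = S.sent n ω' →
      stat (S.positions ω) = stat (S.positions ω') := fun ω ω' h => hr n _ _ _ _ _ _ _ _ h
  exact ⟨mutualInfo_jointLaw_eq_entropy p (fun d => d.2.1) _ stat
      (fun d d' h => (hc d d' h).comp Prod.snd) hr',
    mutualInfo_jointLaw_eq_entropy p (fun d => d.2.1) _ stat hc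
      fun ω ω' h => hr' ω ω' (Prod.ext_iff.1 h).2⟩

/-- The requested subpackets can be decoded if the answers determine them. -/
theorem readCorrect_of_determined [Nonempty F]
    (h : ∀ V w k z w' k' z',
      (∀ n, S.answer n (S.store n w k z) V = S.answer n (S.store n w' k' z') V) →
      ∀ i, w (S.realIdx k (V i)) = w' (S.realIdx k' (V i))) : S.ReadCorrect := by
  have hV : ∀ V, ∃ dec : (Fin N → S.Answer) → Fin Kd → Fin ℓ → F,
      (fun a : Model F B m ℓ × S.Key × S.Noise => fun i => a.1 (S.realIdx a.2.1 (V i))) =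
        dec ∘ fun a n => S.answer n (S.store n a.1 a.2.1 a.2.2) V := by
    intro V
    -- The decoder exists because the requested subpackets are a function of the answers; no formula
    -- for it is needed.
    refine (Function.factorsThrough_iff _).1 fun a a' ha => ?_
    funext i
    exact h V _ _ _ _ _ _ (fun n => congrFun ha n) i
  choose dec hdec using hV
  exact ⟨dec, fun w k z V => (congrFun (hdec V) (w, k, z)).symm⟩

end Scheme

/-! ### Costs -/

section Costs

variable (F : Type*) [Fintype F]

/-- The `Fintype` instance on the product is arbitrary, so that the lemma rewrites whichever
instance a type carries; `Nat.card` removes the dependence on it. -/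
theorem symbols_prod (A A' : Type*) [Fintype A] [Fintype A'] [Fintype (A × A')] [Nonempty A]
    [Nonempty A'] :
    Scheme.symbols F (A × A') = Scheme.symbols F A + Scheme.symbols F A' := by
  simp only [Scheme.symbols, ← Nat.card_eq_fintype_card, Nat.card_prod, Nat.cast_mul]
  exact Real.logb_mul (by simp) (by simp)

theorem symbols_fun (ι A : Type*) [Fintype ι] [Fintype A] [Fintype (ι → A)] :
    Scheme.symbols F (ι → A) = Fintype.card ι * Scheme.symbols F A := by
  simp only [Scheme.symbols, ← Nat.card_eq_fintype_card, Nat.card_fun, Nat.cast_pow]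
  exact Real.logb_pow _ _ _

theorem symbols_matrix (ι κ A : Type*) [Fintype ι] [Fintype κ] [Fintype A]
    [Fintype (Matrix ι κ A)] :
    Scheme.symbols F (Matrix ι κ A) =
      Fintype.card ι * (Fintype.card κ * Scheme.symbols F A) := by
  classical
  rw [← symbols_fun F κ A, ← symbols_fun F ι (κ → A)]
  simp only [Scheme.symbols, ← Nat.card_eq_fintype_card]
  rfl

theorem symbols_self [Nontrivial F] : Scheme.symbols F F = 1 := by
  have : (1 : ℝ) < Fintype.card F := by exact_mod_cast Fintype.one_lt_card
  exact Real.logb_self_eq_one this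

theorem symbols_sub (B m : ℕ) :
    Scheme.symbols F (Sub B m) = Real.logb (Fintype.card F) ((B * m : ℕ) : ℝ) := by
  simp [Scheme.symbols]

variable {F}

/-- From `N = c * ℓ + a` one has `1 - a / N = c * ℓ / N`, which is nonzero because `c` and `ℓ` are;
the rest is cancellation. -/
theorem readingCost_formula {N ℓ P K : ℕ} {c a r lg : ℝ} (hc : c ≠ 0) (hP : P ≠ 0) (hℓ : ℓ ≠ 0)
    (hN0 : N ≠ 0) (hN : (N : ℝ) = c * ℓ + a) (hK : (K : ℝ) = P * r) :
    ((N : ℝ) * K + K * lg) / ((P * ℓ : ℕ) : ℝ) = c * r * (1 + lg / N) / (1 - a / N) := by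
  have hP' : (P : ℝ) ≠ 0 := Nat.cast_ne_zero.2 hP
  have hℓ' : (ℓ : ℝ) ≠ 0 := Nat.cast_ne_zero.2 hℓ
  have hN' : (N : ℝ) ≠ 0 := Nat.cast_ne_zero.2 hN0
  have ha : 1 - a / N = c * ℓ / N := by
    field_simp
    linarith
  rw [ha, hK]
  push_cast
  field_simp

theorem writingCost_formula {N ℓ P K : ℕ} {c a r lg : ℝ} (hc : c ≠ 0) (hP : P ≠ 0) (hℓ : ℓ ≠ 0)
    (hN0 : N ≠ 0) (hN : (N : ℝ) = c * ℓ + a) (hK : (K : ℝ) = P * r) :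
    ((N : ℝ) * (K * (1 + lg))) / ((P * ℓ : ℕ) : ℝ) = c * r * (1 + lg) / (1 - a / N) := by
  have hP' : (P : ℝ) ≠ 0 := Nat.cast_ne_zero.2 hP
  have hℓ' : (ℓ : ℝ) ≠ 0 := Nat.cast_ne_zero.2 hℓ
  have hN' : (N : ℝ) ≠ 0 := Nat.cast_ne_zero.2 hN0
  have ha : 1 - a / N = c * ℓ / N := by
    field_simp
    linarith
  rw [ha, hK]
  push_cast
  field_simp

/-- Total number of downloaded symbols. -/
theorem symbols_download [Nontrivial F] (N B m K : ℕ) :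
    (∑ _n : Fin N, Scheme.symbols F (Fin K → F)) + Scheme.symbols F (Fin K → Sub B m) =
      N * K + K * Real.logb (Fintype.card F) ((B * m : ℕ) : ℝ) := by
  simp [symbols_fun, symbols_self, symbols_sub]

/-- Total number of uploaded symbols. -/
theorem symbols_upload [Nontrivial F] (N B m K : ℕ) (h : B * m ≠ 0) :
    (∑ _n : Fin N, Scheme.symbols F (Tuples F B m K)) =
      N * (K * (1 + Real.logb (Fintype.card F) ((B * m : ℕ) : ℝ))) := by
  have : Nonempty (Sub B m) := by
    rw [← Fintype.card_pos_iff]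
    simpa [Nat.pos_iff_ne_zero] using h
  simp [symbols_fun, symbols_prod, symbols_self, symbols_sub]

end Costs

end PRUW
namespace PRUW

/-! ### One-time pads and increments of the building blocks -/

section Pads

variable {F : Type u} [Field F] {ℓ : ℕ}

/-- The constant noise symbol `z 0` has coefficient `a ^ 0 = 1`, also when `a = 0`, and absorbs any
change of `w`. -/
theorem uncodedSymbol_padded {d : ℕ} (f a w w' : F) :
    ∃ c, ∀ z : Fin (d + 1) → F, uncodedSymbol f a w z = uncodedSymbol f a w' (z + c) := by
  refine ⟨Pi.single 0 ((f - a)⁻¹ * (w - w')), fun z => ?_⟩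
  simp only [uncodedSymbol, Pi.add_apply, mul_add, Finset.sum_add_distrib]
  rw [Finset.sum_eq_single (f := fun j : Fin (d + 1) => a ^ (j : ℕ) * (Pi.single 0 _ : Fin (d + 1) → F) j) 0]
  · simp
    ring
  · intro j _ hj
    rw [Pi.single_eq_of_ne hj, mul_zero]
  · simp

theorem codedSymbol_padded {d : ℕ} (a : F) (w w' : Fin ℓ → F) :
    ∃ c, ∀ z : Fin (d + 1) → F, codedSymbol a w z = codedSymbol a w' (z + c) := by
  refine ⟨Pi.single 0 (∑ i : Fin ℓ, (a ^ ((i : ℕ) + 1))⁻¹ * w i -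
    ∑ i : Fin ℓ, (a ^ ((i : ℕ) + 1))⁻¹ * w' i), fun z => ?_⟩
  simp only [codedSymbol, Pi.add_apply, mul_add, Finset.sum_add_distrib]
  rw [Finset.sum_eq_single (f := fun j : Fin (d + 1) => a ^ (j : ℕ) * (Pi.single 0 _ : Fin (d + 1) → F) j) 0]
  · simp
    ring
  · intro j _ hj
    rw [Pi.single_eq_of_ne hj, mul_zero]
  · simp

theorem uncodedRev_padded {m : ℕ} (f : Fin ℓ → F) (a : F) (π π' : Equiv.Perm (Fin m)) :
    ∃ c, ∀ Z, uncodedRev f a π Z = uncodedRev f a π' (Z + c) :=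
  ⟨uncodedRev f a π 0 - uncodedRev f a π' 0, fun Z => by simp only [uncodedRev]; abel⟩

/-- The noise is multiplied by `I ⊗ Γ⁻¹`, which is invertible because no `f k` equals `a`; the shift
is the change of the matrix multiplied by `I ⊗ Γ`. -/
theorem uncodedInterRev_padded {B : ℕ} {f : Fin ℓ → F} {a : F} (h : ∀ k, f k ≠ a)
    (σ σ' : Equiv.Perm (Fin B)) :
    ∃ c, ∀ Z, uncodedInterRev f a σ Z = uncodedInterRev f a σ' (Z + c) := by
  refine ⟨Matrix.kroneckerMap (· * ·) (1 : Matrix (Fin B) (Fin B) F)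
      (Matrix.diagonal fun k => (f k - a)⁻¹) *
    (uncodedInterRev f a σ 0 - uncodedInterRev f a σ' 0), fun Z => ?_⟩
  have h1 : Matrix.kroneckerMap (· * ·) (1 : Matrix (Fin B) (Fin B) F)
        (Matrix.diagonal fun k => f k - a) *
      Matrix.kroneckerMap (· * ·) (1 : Matrix (Fin B) (Fin B) F)
        (Matrix.diagonal fun k => (f k - a)⁻¹) = 1 := by
    have h2 := Matrix.mul_kronecker_mul (1 : Matrix (Fin B) (Fin B) F)
      (1 : Matrix (Fin B) (Fin B) F)
      (Matrix.diagonal fun k => f k - a) (Matrix.diagonal fun k => (f k - a)⁻¹)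
    refine h2.symm.trans ?_
    rw [Matrix.diagonal_mul_diagonal, mul_one]
    simp only [mul_inv_cancel₀ (sub_ne_zero.2 (h _)), Matrix.diagonal_one]
    exact Matrix.one_kronecker_one
  simp only [uncodedInterRev, mul_add, ← mul_assoc, h1, mul_zero, one_mul]
  abel

theorem codedRev_padded {b : ℕ} {a : F} (h : a ≠ 0) (π π' : Equiv.Perm (Fin b)) :
    ∃ c, ∀ Z, codedRev ℓ a π Z = codedRev ℓ a π' (Z + c) := by
  refine ⟨(a ^ ℓ)⁻¹ • (permRev F π - permRev F π'), fun Z => ?_⟩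
  rw [codedRev, codedRev, smul_add, smul_smul, mul_inv_cancel₀ (pow_ne_zero ℓ h), one_smul]
  abel

/-- The coefficient `∏ⱼ (f j - a)` of the noise is nonzero, so the noise is a one-time pad. -/
theorem uncodedComb_padded {f : Fin ℓ → F} {a : F} (h : ∀ k, f k ≠ a) (δ δ' : Fin ℓ → F) :
    ∃ c, ∀ z, uncodedComb f a δ z = uncodedComb f a δ' (z + c) := by
  refine ⟨(∏ j, (f j - a))⁻¹ * (uncodedComb f a δ 0 - uncodedComb f a δ' 0), fun z => ?_⟩
  simp only [uncodedComb, mul_add, mul_inv_cancel_left₀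
    (Finset.prod_ne_zero_iff.2 fun j _ => sub_ne_zero.2 (h j))]
  ring

theorem codedComb_padded (a : F) (δ δ' : Fin ℓ → F) :
    ∃ c, ∀ z, codedComb a δ z = codedComb a δ' (z + c) := by
  refine ⟨codedComb a δ 0 - codedComb a δ' 0, fun z => ?_⟩
  simp only [codedComb]
  ring

theorem uncodedComb_zero (f : Fin ℓ → F) (a : F) : uncodedComb f a 0 0 = 0 := by
  simp [uncodedComb]

theorem codedComb_zero (a : F) : codedComb (ℓ := ℓ) a 0 0 = 0 := by
  simp [codedComb]

/-- Adding an increment that is the update up to interference is the same as updating the stored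
value and shifting the noise by the coefficients of the interference. -/
theorem uncodedSymbol_add {d : ℕ} (f a w Δ : F) (z c : Fin d → F) {g : F}
    (h : g - (f - a)⁻¹ * Δ = ∑ j : Fin d, a ^ (j : ℕ) * c j) :
    uncodedSymbol f a w z + g = uncodedSymbol f a (w + Δ) (z + c) := by
  simp only [uncodedSymbol, Pi.add_apply, mul_add, Finset.sum_add_distrib, ← h]
  ring

theorem codedSymbol_add {d : ℕ} (a : F) (w Δ : Fin ℓ → F) (z c : Fin d → F) {g : F}
    (h : g - ∑ i : Fin ℓ, (a ^ ((i : ℕ) + 1))⁻¹ * Δ i = ∑ j : Fin d, a ^ (j : ℕ) * c j) :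
    codedSymbol a w z + g = codedSymbol a (w + Δ) (z + c) := by
  simp only [codedSymbol, Pi.add_apply, mul_add, Finset.sum_add_distrib, ← h]
  ring

/-- Addition to the first component of a term that depends on the second component. -/
def addShear {A A' : Type*} [AddGroup A] (c : A' → A) : A × A' ≃ A × A' where
  toFun z := (z.1 + c z.2, z.2)
  invFun z := (z.1 - c z.2, z.2)
  left_inv z := by simp
  right_inv z := by simp

end Pads

/-! ### Noisy reversing matrices up to polynomial interference -/

section Rev

variable {F ι : Type*} [Field F] {B m ℓ : ℕ} {f : Fin ℓ → F} {α : ι → F}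

theorem uncodedRev_sub_mem_polyFun (π : Equiv.Perm (Fin m))
    (Z : Matrix (Fin m × Fin ℓ) (Fin m × Fin ℓ) F) (a b : Fin m × Fin ℓ) :
    (fun n => uncodedRev f (α n) π Z a b -
      if a.1 = π b.1 ∧ a.2 = b.2 then (f a.2 - α n)⁻¹ else 0) ∈ polyFun α 0 := by
  convert const_mem_polyFun (α := α) (d := 0) (Z a b) using 2 with n
  by_cases h1 : a.1 = π b.1 <;> by_cases h2 : a.2 = b.2 <;>
    simp [uncodedRev, permRev, h1, h2]

theorem uncodedCombined_sub_mem_polyFun (hfα : ∀ k n, f k ≠ α n)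
    (π : Fin B → Equiv.Perm (Fin m)) (σ : Equiv.Perm (Fin B))
    (Z : Fin B → Matrix (Fin m × Fin ℓ) (Fin m × Fin ℓ) F)
    (Z' : Matrix (Fin B × Fin ℓ) (Fin B × Fin ℓ) F) (a b : Sub B m × Fin ℓ) :
    (fun n => uncodedCombined (fun j => uncodedRev f (α n) (π j) (Z j))
        (uncodedInterRev f (α n) σ Z') a b -
      if a.1 = twoStageIdx π σ b.1 ∧ a.2 = b.2 then (f a.2 - α n)⁻¹ else 0) ∈
      polyFun α 1 := by
  obtain ⟨⟨i, t⟩, k⟩ := a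
  obtain ⟨⟨j, t'⟩, k'⟩ := b
  have hterm : ∀ h : Fin ℓ, (fun n =>
      uncodedRev f (α n) (π i) (Z i) (t, k) (t', h) *
        uncodedInterRev f (α n) σ Z' (i, h) (j, k') -
      if h = k then (if (i, t) = twoStageIdx π σ (j, t') ∧ k = k' then (f k - α n)⁻¹ else 0)
        else 0) ∈ polyFun α 1 := by
    intro h
    -- The product `(Γ R + Z)(R̂ + Γ⁻¹ Z')` expanded: beyond the wanted `Γ R R̂`, the pole in `Γ R
    -- Γ⁻¹ Z'` cancels, `Z R̂` is constant, and `Z Γ⁻¹ Z'` has degree 1.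
    have h1 : (fun n => (if t = π i t' ∧ k = h then Z' (i, k) (j, k') else 0) +
        (Z i (t, k) (t', h) * (if i = σ j ∧ h = k' then 1 else 0) +
        (f h - α n) * (Z i (t, k) (t', h) * Z' (i, h) (j, k')))) ∈ polyFun α 1 :=
      add_mem_polyFun (const_mem_polyFun _) (add_mem_polyFun (const_mem_polyFun _)
        (mul_const_mem_polyFun (sub_mem_polyFun _) _))
    convert h1 using 2 with n
    have hR : uncodedRev f (α n) (π i) (Z i) (t, k) (t', h) =
        (if t = π i t' ∧ k = h then (f k - α n)⁻¹ else 0) + Z i (t, k) (t', h) := by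
      by_cases h1 : t = π i t' <;> by_cases h2 : k = h <;> simp [uncodedRev, permRev, h1, h2]
    have hH : uncodedInterRev f (α n) σ Z' (i, h) (j, k') =
        (if i = σ j ∧ h = k' then 1 else 0) + (f h - α n) * Z' (i, h) (j, k') := by
      have : (Matrix.kroneckerMap (· * ·) (1 : Matrix (Fin B) (Fin B) F)
          (Matrix.diagonal fun k => f k - α n) * Z') (i, h) (j, k') =
          (f h - α n) * Z' (i, h) (j, k') := by
        rw [← Matrix.diagonal_one, Matrix.diagonal_kronecker_diagonal, Matrix.diagonal_mul,
          one_mul]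
      rw [uncodedInterRev, Matrix.add_apply, this]
      by_cases h1 : i = σ j <;> by_cases h2 : h = k' <;>
        simp [permRev, h1, h2]
    rw [hR, hH]
    have hτ : (i, t) = twoStageIdx π σ (j, t') ↔ i = σ j ∧ t = π i t' := by
      simp only [twoStageIdx, Equiv.prodShear_apply, Prod.mk.injEq]
      exact and_congr_right fun hi => by rw [hi]
    simp only [hτ]
    have hne := sub_ne_zero.2 (hfα k n)
    by_cases h2 : k = h
    · subst h2
      rcases Classical.propComplete (t = π i t') with h1 | h1 <;>
        rcases Classical.propComplete (i = σ j) with h3 | h3 <;>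
        rcases Classical.propComplete (k = k') with h4 | h4 <;>
        simp only [h1, h3, h4, and_true, and_false, if_true, if_false] <;>
        field_simp <;> ring
    · simp only [h2, Ne.symm h2, and_false, if_false]
      ring
  have := sum_mem_polyFun (s := Finset.univ) fun h _ => hterm h
  convert this using 2 with n
  rw [Finset.sum_sub_distrib, Finset.sum_ite_eq' Finset.univ k, if_pos (Finset.mem_univ k)]
  rfl

theorem codedRev_eq_add (π : Equiv.Perm (Fin m)) (Z : Matrix (Fin m) (Fin m) F)
    (s t : Fin m) :
    ∃ c ∈ polyFun α 0, ∀ n,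
      codedRev ℓ (α n) π Z s t = (if s = π t then 1 else 0) + α n ^ ℓ * c n :=
  ⟨_, const_mem_polyFun (Z s t), fun n => by simp [codedRev, permRev]⟩

/-- With `δ`, `δ'` the entries of the two permutation matrices, `(δ + α ^ ℓ Z)(δ' + α ^ ℓ Z')` is `δ
δ'` plus `α ^ ℓ` times `δ Z' + Z δ' + α ^ ℓ Z Z'`, and the latter has degree `ℓ`. -/
theorem codedCombined_eq_add (π : Fin B → Equiv.Perm (Fin m)) (σ : Equiv.Perm (Fin B))
    (Z : Fin B → Matrix (Fin m) (Fin m) F) (Z' : Matrix (Fin B) (Fin B) F) (s t : Sub B m) :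
    ∃ c ∈ polyFun α ℓ, ∀ n,
      codedCombined (fun j => codedRev ℓ (α n) (π j) (Z j)) (codedRev ℓ (α n) σ Z') s t =
        (if s = twoStageIdx π σ t then 1 else 0) + α n ^ ℓ * c n := by
  obtain ⟨i, a⟩ := s
  obtain ⟨j, b⟩ := t
  refine ⟨_, add_mem_polyFun (const_mem_polyFun
      ((if a = π i b then 1 else 0) * Z' i j + Z i a b * if i = σ j then 1 else 0))
    (mul_const_mem_polyFun (pow_mem_polyFun le_rfl) (Z i a b * Z' i j)), fun n => ?_⟩
  have hτ : (i, a) = twoStageIdx π σ (j, b) ↔ i = σ j ∧ a = π i b := by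
    simp only [twoStageIdx, Equiv.prodShear_apply, Prod.mk.injEq]
    exact and_congr_right fun hi => by rw [hi]
  simp only [codedCombined, codedRev, permRev, Matrix.of_apply, Matrix.add_apply,
    Matrix.smul_apply, smul_eq_mul, hτ]
  rcases Classical.propComplete (i = σ j) with h1 | h1 <;>
    rcases Classical.propComplete (a = π i b) with h2 | h2 <;>
    simp only [h1, h2, and_true, and_false, if_true, if_false] <;> ring

end Rev

end PRUW
namespace PRUW

/-! ### The four schemes -/

-- Uniqueness of the decoded values

section Unique

variable {F : Type u} [Field F] {N ℓ : ℕ} {f : Fin ℓ → F} {α : Fin N → F}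

theorem uncoded_values_unique {d : ℕ} (hf : Function.Injective f) (hα : Function.Injective α)
    (hfα : ∀ k n, f k ≠ α n) (hd : d + ℓ < N) {g : Fin N → F} {v v' : Fin ℓ → F}
    (h : (fun n => g n - ∑ k, (f k - α n)⁻¹ * v k) ∈ polyFun α d)
    (h' : (fun n => g n - ∑ k, (f k - α n)⁻¹ * v' k) ∈ polyFun α d) : v = v' := by
  rw [← sub_eq_zero]
  refine eq_zero_of_sum_inv_mul_mem_polyFun hf hα hfα (by simpa using hd) ?_
  have := (polyFun α d).sub_mem h' h
  convert this using 2 with n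
  simp [mul_sub]

theorem coded_values_unique {d : ℕ} (hα : Function.Injective α) (hα0 : ∀ n, α n ≠ 0)
    (hd : d + ℓ < N) {g : Fin N → F} {v v' : Fin ℓ → F}
    (h : (fun n => g n - ∑ i : Fin ℓ, (α n ^ ((i : ℕ) + 1))⁻¹ * v i) ∈ polyFun α d)
    (h' : (fun n => g n - ∑ i : Fin ℓ, (α n ^ ((i : ℕ) + 1))⁻¹ * v' i) ∈ polyFun α d) :
    v = v' := by
  rw [← sub_eq_zero]
  refine eq_zero_of_sum_pow_inv_mul_mem_polyFun hα hα0 (by simpa using hd) ?_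
  have := (polyFun α d).sub_mem h' h
  convert this using 2 with n
  simp [mul_sub]

end Unique

-- The uncoded schemes (cases 1 and 3)

section Uncoded

variable {F : Type u} [Field F] [Fintype F] {N ℓ : ℕ} {f : Fin ℓ → F} {α : Fin N → F}
  {B m Ku Kd : ℕ}

theorem scheme1_storePadded : (scheme1 f α B m Ku Kd).StorePadded := by
  intro n w π w' π'
  choose c hc using fun s k => uncodedSymbol_padded (d := ℓ) (f k) (α n) (w s k) (w' s k)
  choose C hC using fun j => uncodedRev_padded f (α n) (π j) (π' j)
  exact ⟨(Equiv.addRight (c, C) :), fun z =>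
    Prod.ext (funext fun s => funext fun k => hc s k _) (funext fun j => hC j _)⟩

theorem scheme1_writePadded (hf : Function.Injective f) (hfα : ∀ k n, f k ≠ α n) :
    (scheme1 f α B m Ku Kd).WritePadded := by
  intro w π u x δ
  choose c hc using fun (Z : Fin B → Matrix (Fin m × Fin ℓ) (Fin m × Fin ℓ) F) (s : Sub B m)
      (k : Fin ℓ) => exists_coeff_of_mem_polyFun (uncoded_update_sub_mem_polyFun hf hfα
    (uncodedRev_sub_mem_polyFun (π s.1) (Z s.1)) (fun t => sparseUpdate x δ (s.1, t))
    (fun t => ∑ i, if (x.permuted (withinIdx π)).nth i = (s.1, t) then u i else 0) s.2 k)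
  -- The coefficients of the interference depend on the noise of the reversing matrices but not on
  -- that of the data, so adding them to the data noise is a bijection. They are the same for all
  -- databases.
  refine ⟨addShear c, fun z n => Prod.ext ?_ rfl⟩
  funext s k
  refine uncodedSymbol_add _ _ _ _ _ _ ((congrArg (· - _) ?_).trans (hc z.2 s k n))
  refine Finset.sum_congr rfl fun b _ => congrArg (fun y : F => _ * y) ?_
  exact updateVector_tuples (uncodedComb_zero f (α n)) _ _ _ _ _

theorem scheme1_uploadPadded (hfα : ∀ k n, f k ≠ α n) :
    (scheme1 f α B m Ku Kd).UploadPadded := fun n _ _ _ _ δ δ' h =>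
  tuples_coupled (uncodedComb_padded fun k => hfα k n) h δ δ'

theorem scheme1_keyPadded : (scheme1 f α B m Ku Kd).KeyPadded segCounts :=
  fun _ _ h => exists_withinIdx_equiv h

theorem scheme1_uploadReveals : (scheme1 f α B m Ku Kd).UploadReveals segCounts := by
  intro n π π' u u' x x' δ δ' h
  exact (segCounts_permuted_withinIdx π x).symm.trans
    ((congrArg segCounts (permuted_eq_of_tuples_eq h)).trans (segCounts_permuted_withinIdx π' x'))

theorem scheme1_readCorrect (hf : Function.Injective f) (hα : Function.Injective α)
    (hfα : ∀ k n, f k ≠ α n) (hN : 2 * ℓ + 2 ≤ N) :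
    (scheme1 f α B m Ku Kd).ReadCorrect := by
  refine Scheme.readCorrect_of_determined fun V w π z w' π' z' h i => ?_
  have key : ∀ (w : Model F B m ℓ) π z, (fun n => (scheme1 f α B m Ku Kd).answer n
      ((scheme1 f α B m Ku Kd).store n w π z) V i -
      ∑ k, (f k - α n)⁻¹ * w (withinIdx π (V i)) k) ∈ polyFun α (ℓ + 1 + 0) := by
    intro w π z
    -- Only the segment of the requested index enters the answer, so the general lemma is applied
    -- inside that segment.
    exact uncoded_answer_sub_mem_polyFun hfα
      (uncodedRev_sub_mem_polyFun (π (V i).1) (z.2 (V i).1))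
      (w := fun s k => w ((V i).1, s) k)
      (fun s k => uncodedSymbol_sub_mem_polyFun k _ (z.1 ((V i).1, s) k)) (V i).2
  -- The interference has degree `ℓ + 1`, and `(ℓ + 1) + ℓ < 2 * ℓ + 2`.
  refine uncoded_values_unique hf hα hfα (by omega) (key w π z) ?_
  simp only [fun n => congrFun (h n) i]
  exact key w' π' z'

theorem scheme3_storePadded (hfα : ∀ k n, f k ≠ α n) :
    (scheme3 f α B m Ku Kd).StorePadded := by
  intro n w κ w' κ'
  choose c hc using fun s k => uncodedSymbol_padded (d := ℓ + 1) (f k) (α n) (w s k) (w' s k)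
  choose C hC using fun j => uncodedRev_padded f (α n) (κ.1 j) (κ'.1 j)
  obtain ⟨C', hC'⟩ := uncodedInterRev_padded (fun k => hfα k n) κ.2 κ'.2
  exact ⟨(Equiv.addRight (c, C, C') :), fun z =>
    Prod.ext (funext fun s => funext fun k => hc s k _)
      (Prod.ext (funext fun j => hC j _) (hC' _))⟩

theorem scheme3_writePadded (hf : Function.Injective f) (hfα : ∀ k n, f k ≠ α n) :
    (scheme3 f α B m Ku Kd).WritePadded := by
  intro w κ u x δ
  choose c hc using fun (Z : (Fin B → Matrix (Fin m × Fin ℓ) (Fin m × Fin ℓ) F) ×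
      Matrix (Fin B × Fin ℓ) (Fin B × Fin ℓ) F) (s : Sub B m)
      (k : Fin ℓ) => exists_coeff_of_mem_polyFun (uncoded_update_sub_mem_polyFun hf hfα
    (uncodedCombined_sub_mem_polyFun hfα κ.1 κ.2 Z.1 Z.2) (sparseUpdate x δ)
    (fun t => ∑ i, if (x.permuted (twoStageIdx κ.1 κ.2)).nth i = t then u i else 0) s k)
  refine ⟨addShear c, fun z n => Prod.ext ?_ rfl⟩
  funext s k
  refine uncodedSymbol_add _ _ _ _ _ _ ((congrArg (· - _) ?_).trans (hc z.2 s k n))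
  refine Finset.sum_congr rfl fun b _ => congrArg (fun y : F => _ * y) ?_
  exact updateVector_tuples (uncodedComb_zero f (α n)) _ _ _ _ _

theorem scheme3_uploadPadded (hfα : ∀ k n, f k ≠ α n) :
    (scheme3 f α B m Ku Kd).UploadPadded := fun n _ _ _ _ δ δ' h =>
  tuples_coupled (uncodedComb_padded fun k => hfα k n) h δ δ'

theorem scheme3_keyPadded : (scheme3 f α B m Ku Kd).KeyPadded unorderedCounts :=
  fun _ _ h => exists_twoStageIdx_equiv h

theorem scheme3_uploadReveals : (scheme3 f α B m Ku Kd).UploadReveals unorderedCounts := by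
  intro n κ κ' u u' x x' δ δ' h
  exact (unorderedCounts_permuted_twoStageIdx κ.1 κ.2 x).symm.trans
    ((congrArg unorderedCounts (permuted_eq_of_tuples_eq h)).trans
      (unorderedCounts_permuted_twoStageIdx κ'.1 κ'.2 x'))

theorem scheme3_readCorrect (hf : Function.Injective f) (hα : Function.Injective α)
    (hfα : ∀ k n, f k ≠ α n) (hN : 2 * ℓ + 4 ≤ N) :
    (scheme3 f α B m Ku Kd).ReadCorrect := by
  refine Scheme.readCorrect_of_determined fun V w κ z w' κ' z' h i => ?_
  have key : ∀ (w : Model F B m ℓ) κ z, (fun n => (scheme3 f α B m Ku Kd).answer n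
      ((scheme3 f α B m Ku Kd).store n w κ z) V i -
      ∑ k, (f k - α n)⁻¹ * w (twoStageIdx κ.1 κ.2 (V i)) k) ∈ polyFun α (ℓ + 1 + 1 + 1) := by
    intro w κ z
    have := uncoded_answer_sub_mem_polyFun hfα
      (uncodedCombined_sub_mem_polyFun hfα κ.1 κ.2 z.2.1 z.2.2) (w := w)
      (fun s k => uncodedSymbol_sub_mem_polyFun k _ (z.1 s k)) (V i)
    convert this using 2 with n
    congr 1
    refine Finset.sum_congr rfl fun s _ => Finset.sum_congr rfl fun k _ => ?_
    rw [mul_comm (f k - α n) (uncodedSymbol _ _ _ _), mul_assoc]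
    rfl
  -- The interference has degree `ℓ + 3`: `ℓ + 1` from the storage, 1 from the rescaling and 1 from
  -- the combined matrix; and `(ℓ + 3) + ℓ < 2 * ℓ + 4`.
  refine uncoded_values_unique hf hα hfα (by omega) (key w κ z) ?_
  simp only [fun n => congrFun (h n) i]
  exact key w' κ' z'

end Uncoded

-- The MDS coded schemes (cases 2 and 4)

section Coded

variable {F : Type u} [Field F] [Fintype F] {N ℓ : ℕ} {α : Fin N → F} {B m Ku Kd : ℕ}

theorem scheme2_storePadded (hα0 : ∀ n, α n ≠ 0) :
    (scheme2 α B m ℓ Ku Kd).StorePadded := by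
  intro n w π w' π'
  choose c hc using fun s => codedSymbol_padded (d := ℓ) (α n) (w s) (w' s)
  choose C hC using fun j => codedRev_padded (ℓ := ℓ) (hα0 n) (π j) (π' j)
  exact ⟨(Equiv.addRight (c, C) :), fun z =>
    Prod.ext (funext fun s => hc s _) (funext fun j => hC j _)⟩

theorem scheme2_writePadded (hα0 : ∀ n, α n ≠ 0) :
    (scheme2 α B m ℓ Ku Kd).WritePadded := by
  intro w π u x δ
  choose c hc using fun (Z : Fin B → Matrix (Fin m) (Fin m) F) (s : Sub B m) =>
    exists_coeff_of_mem_polyFun (coded_update_sub_mem_polyFun hα0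
      (codedRev_eq_add (π s.1) (Z s.1)) (fun t => sparseUpdate x δ (s.1, t))
      (fun t => ∑ i, if (x.permuted (withinIdx π)).nth i = (s.1, t) then u i else 0) s.2)
  refine ⟨addShear c, fun z n => Prod.ext ?_ rfl⟩
  funext s
  refine codedSymbol_add _ _ _ _ _ ((congrArg (· - _) ?_).trans (hc z.2 s n))
  change ∑ t, codedRev ℓ (α n) (π s.1) (z.2 s.1) s.2 t * _ = _
  refine Finset.sum_congr rfl fun b _ => congrArg (fun y : F => _ * y) ?_
  exact updateVector_tuples (codedComb_zero (α n)) _ _ _ _ _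

theorem scheme2_uploadPadded : (scheme2 α B m ℓ Ku Kd).UploadPadded :=
  fun n _ _ _ _ δ δ' h => tuples_coupled (codedComb_padded (α n)) h δ δ'

theorem scheme2_keyPadded : (scheme2 α B m ℓ Ku Kd).KeyPadded segCounts :=
  fun _ _ h => exists_withinIdx_equiv h

theorem scheme2_uploadReveals : (scheme2 α B m ℓ Ku Kd).UploadReveals segCounts := by
  intro n π π' u u' x x' δ δ' h
  exact (segCounts_permuted_withinIdx π x).symm.trans
    ((congrArg segCounts (permuted_eq_of_tuples_eq h)).trans (segCounts_permuted_withinIdx π' x'))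

theorem scheme2_readCorrect (hα : Function.Injective α) (hα0 : ∀ n, α n ≠ 0)
    (hN : 3 * ℓ + 1 ≤ N) : (scheme2 α B m ℓ Ku Kd).ReadCorrect := by
  refine Scheme.readCorrect_of_determined fun V w π z w' π' z' h i => ?_
  have key : ∀ (w : Model F B m ℓ) π z, (fun n => (scheme2 α B m ℓ Ku Kd).answer n
      ((scheme2 α B m ℓ Ku Kd).store n w π z) V i -
      ∑ j : Fin ℓ, (α n ^ ((j : ℕ) + 1))⁻¹ * w (withinIdx π (V i)) j) ∈
      polyFun α (ℓ + ℓ + 0) := by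
    intro w π z
    exact coded_answer_sub_mem_polyFun hα0
      (codedRev_eq_add (π (V i).1) (z.2 (V i).1))
      (w := fun s => w ((V i).1, s))
      (fun s => codedSymbol_sub_mem_polyFun _ (z.1 ((V i).1, s))) (V i).2
  -- The interference has degree `2 * ℓ`, and `2 * ℓ + ℓ < 3 * ℓ + 1`.
  refine coded_values_unique hα hα0 (by omega) (key w π z) ?_
  simp only [fun n => congrFun (h n) i]
  exact key w' π' z'

theorem scheme4_storePadded (hα0 : ∀ n, α n ≠ 0) :
    (scheme4 α B m ℓ Ku Kd).StorePadded := by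
  intro n w κ w' κ'
  choose c hc using fun s => codedSymbol_padded (d := 2 * ℓ) (α n) (w s) (w' s)
  choose C hC using fun j => codedRev_padded (ℓ := ℓ) (hα0 n) (κ.1 j) (κ'.1 j)
  obtain ⟨C', hC'⟩ := codedRev_padded (ℓ := ℓ) (hα0 n) κ.2 κ'.2
  exact ⟨(Equiv.addRight (c, C, C') :), fun z =>
    Prod.ext (funext fun s => hc s _) (Prod.ext (funext fun j => hC j _) (hC' _))⟩

theorem scheme4_writePadded (hα0 : ∀ n, α n ≠ 0) :
    (scheme4 α B m ℓ Ku Kd).WritePadded := by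
  intro w κ u x δ
  -- Writing through the combined matrix causes interference of degree `ℓ + ℓ`, which is the degree
  -- `2 * ℓ` of the storage noise in this case.
  choose c hc using fun (Z : (Fin B → Matrix (Fin m) (Fin m) F) × Matrix (Fin B) (Fin B) F)
      (s : Sub B m) => exists_coeff_of_mem_polyFun (polyFun_mono (two_mul ℓ).ge
    (coded_update_sub_mem_polyFun hα0 (codedCombined_eq_add κ.1 κ.2 Z.1 Z.2) (sparseUpdate x δ)
      (fun t => ∑ i, if (x.permuted (twoStageIdx κ.1 κ.2)).nth i = t then u i else 0) s))
  refine ⟨addShear c, fun z n => Prod.ext ?_ rfl⟩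
  funext s
  refine codedSymbol_add _ _ _ _ _ ((congrArg (· - _) ?_).trans (hc z.2 s n))
  refine Finset.sum_congr rfl fun b _ => congrArg (fun y : F => _ * y) ?_
  exact updateVector_tuples (codedComb_zero (α n)) _ _ _ _ _

theorem scheme4_uploadPadded : (scheme4 α B m ℓ Ku Kd).UploadPadded :=
  fun n _ _ _ _ δ δ' h => tuples_coupled (codedComb_padded (α n)) h δ δ'

theorem scheme4_keyPadded : (scheme4 α B m ℓ Ku Kd).KeyPadded unorderedCounts :=
  fun _ _ h => exists_twoStageIdx_equiv h

theorem scheme4_uploadReveals : (scheme4 α B m ℓ Ku Kd).UploadReveals unorderedCounts := by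
  intro n κ κ' u u' x x' δ δ' h
  exact (unorderedCounts_permuted_twoStageIdx κ.1 κ.2 x).symm.trans
    ((congrArg unorderedCounts (permuted_eq_of_tuples_eq h)).trans
      (unorderedCounts_permuted_twoStageIdx κ'.1 κ'.2 x'))

theorem scheme4_readCorrect (hα : Function.Injective α) (hα0 : ∀ n, α n ≠ 0)
    (hN : 5 * ℓ + 1 ≤ N) : (scheme4 α B m ℓ Ku Kd).ReadCorrect := by
  refine Scheme.readCorrect_of_determined fun V w κ z w' κ' z' h i => ?_
  have key : ∀ (w : Model F B m ℓ) κ z, (fun n => (scheme4 α B m ℓ Ku Kd).answer n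
      ((scheme4 α B m ℓ Ku Kd).store n w κ z) V i -
      ∑ j : Fin ℓ, (α n ^ ((j : ℕ) + 1))⁻¹ * w (twoStageIdx κ.1 κ.2 (V i)) j) ∈
      polyFun α (ℓ + 2 * ℓ + ℓ) := by
    intro w κ z
    exact coded_answer_sub_mem_polyFun hα0
      (codedCombined_eq_add κ.1 κ.2 z.2.1 z.2.2) (w := w)
      (fun s => codedSymbol_sub_mem_polyFun _ (z.1 s)) (V i)
  -- The interference has degree `4 * ℓ`: `2 * ℓ` from the storage, `ℓ` from clearing its poles and
  -- `ℓ` from the combined matrix; and `4 * ℓ + ℓ < 5 * ℓ + 1`.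
  refine coded_values_unique hα hα0 (by omega) (key w κ z) ?_
  simp only [fun n => congrFun (h n) i]
  exact key w' κ' z'

end Coded

end PRUW
namespace PRUW

theorem Scheme.achieves_of_padded {F : Type u} [Field F] [Fintype F] {N B m ℓ Ku Kd : ℕ}
    {S : Scheme F N B m ℓ Ku Kd} {T : Type*} {stat : Positions B m Ku → T} {CR CW : ℝ}
    (hread : S.ReadCorrect) (hs : S.StorePadded) (hw : S.WritePadded) (hu : S.UploadPadded)
    (hk : S.KeyPadded stat) (hr : S.UploadReveals stat) (hCR : S.readingCost = CR)
    (hCW : S.writingCost = CW) : S.Achieves stat CR CW where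
  readCorrect := hread
  writeCorrect := hw.writeCorrect
  secure := secure_of_padded hs hw
  valuesPrivate := valuesPrivate_of_padded hs hu hk
  positionLeakage := positionLeakage_of_padded hs hu hk hr
  readingCost_eq := hCR
  writingCost_eq := hCW

-- Storage complexity

section Storage

variable {F : Type u} [Field F] [Fintype F] {N ℓ B m Ku Kd : ℕ}

theorem scheme1_storageSize (f : Fin ℓ → F) (α : Fin N → F) :
    (scheme1 f α B m Ku Kd).storageSize = B * m * ℓ + B * (m * ℓ) ^ 2 := by
  have : (scheme1 f α B m Ku Kd).storageSize = Scheme.symbols F ((Sub B m → Fin ℓ → F) ×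
    (Fin B → Matrix (Fin m × Fin ℓ) (Fin m × Fin ℓ) F)) := rfl
  rw [this]
  simp only [symbols_prod, symbols_fun, symbols_matrix, symbols_self, Fintype.card_prod,
    Fintype.card_fin, Nat.cast_mul]
  ring

theorem scheme2_storageSize (α : Fin N → F) :
    (scheme2 α B m ℓ Ku Kd).storageSize = B * m + B * m ^ 2 := by
  have : (scheme2 α B m ℓ Ku Kd).storageSize = Scheme.symbols F ((Sub B m → F) ×
    (Fin B → Matrix (Fin m) (Fin m) F)) := rfl
  rw [this]
  simp only [symbols_prod, symbols_fun, symbols_matrix, symbols_self, Fintype.card_prod,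
    Fintype.card_fin, Nat.cast_mul]
  ring

theorem scheme3_storageSize (f : Fin ℓ → F) (α : Fin N → F) :
    (scheme3 f α B m Ku Kd).storageSize = B * m * ℓ + B * (m * ℓ) ^ 2 + (B * ℓ) ^ 2 := by
  have : (scheme3 f α B m Ku Kd).storageSize = Scheme.symbols F ((Sub B m → Fin ℓ → F) ×
    (Fin B → Matrix (Fin m × Fin ℓ) (Fin m × Fin ℓ) F) ×
    Matrix (Fin B × Fin ℓ) (Fin B × Fin ℓ) F) := rfl
  rw [this]
  simp only [symbols_prod, symbols_fun, symbols_matrix, symbols_self, Fintype.card_prod,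
    Fintype.card_fin, Nat.cast_mul]
  ring

theorem scheme4_storageSize (α : Fin N → F) :
    (scheme4 α B m ℓ Ku Kd).storageSize = B * m + B * m ^ 2 + B ^ 2 := by
  have : (scheme4 α B m ℓ Ku Kd).storageSize = Scheme.symbols F ((Sub B m → F) ×
    (Fin B → Matrix (Fin m) (Fin m) F) × Matrix (Fin B) (Fin B) F) := rfl
  rw [this]
  simp only [symbols_prod, symbols_fun, symbols_matrix, symbols_self, Fintype.card_prod,
    Fintype.card_fin, Nat.cast_mul]
  ring

theorem storage_le_of_uncoded {B m ℓ : ℝ} (hB : 1 ≤ B) (hm : 1 ≤ m) (hℓ : 1 ≤ ℓ) :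
    B * m * ℓ + B * (m * ℓ) ^ 2 ≤ 2 * ((B * m * ℓ) ^ 2 / B) := by
  have h : (B * m * ℓ) ^ 2 / B = B * (m * ℓ) ^ 2 := by
    field_simp
  have h1 : 1 ≤ m * ℓ := one_le_mul_of_one_le_of_one_le hm hℓ
  have h2 : B * (m * ℓ) ≤ B * (m * ℓ) ^ 2 :=
    mul_le_mul_of_nonneg_left (le_self_pow₀ h1 two_ne_zero) (by linarith)
  rw [h]
  linarith

/-- `N ^ 2 ≤ c * ℓ ^ 2` turns `ℓ ^ 2 / N ^ 2` into a constant, and `m ≤ m ^ 2` lets the matrices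
dominate the data. -/
theorem storage_le_of_coded {B m ℓ N c : ℝ} (hB : 1 ≤ B) (hm : 1 ≤ m) (hℓ : 1 ≤ ℓ)
    (hN : N ^ 2 ≤ c * ℓ ^ 2) (hN0 : 0 < N) :
    B * m + B * m ^ 2 ≤ 2 * c * ((B * m * ℓ) ^ 2 / (B * N ^ 2)) := by
  have h : 2 * c * ((B * m * ℓ) ^ 2 / (B * N ^ 2)) = 2 * (B * m ^ 2) * (c * ℓ ^ 2 / N ^ 2) := by
    field_simp
  have h1 : 1 ≤ c * ℓ ^ 2 / N ^ 2 := (one_le_div (by positivity)).2 hN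
  have h2 : B * m ≤ B * m ^ 2 :=
    mul_le_mul_of_nonneg_left (le_self_pow₀ hm two_ne_zero) (by linarith)
  have h3 := mul_le_mul_of_nonneg_left h1 (by positivity : 0 ≤ 2 * (B * m ^ 2))
  rw [h]
  linarith

end Storage

end PRUW

-- The theorem

theorem theorem1 :
    -- one absolute constant for the orders of the four storage complexities
    ∃ C : ℝ, ∀ (F : Type u) [Field F] [Fintype F] (N P B m ℓ L Ku Kd : ℕ) (r r' : ℝ),
      1 ≤ B → B < P → P = B * m → 1 ≤ ℓ → L = P * ℓ →
      (Ku : ℝ) = P * r → (Kd : ℝ) = P * r' →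
      -- case 1
      (∀ (f : Fin ℓ → F) (α : Fin N → F), Function.Injective f → Function.Injective α →
        (∀ i n, f i ≠ α n) → N = 2 * ℓ + 2 →
        (PRUW.scheme1 f α B m Ku Kd).Achieves PRUW.segCounts
          (2 * r' * (1 + Real.logb (Fintype.card F) P / N) / (1 - 2 / N))
          (2 * r * (1 + Real.logb (Fintype.card F) P) / (1 - 2 / N)) ∧
        (PRUW.scheme1 f α B m Ku Kd).storageSize ≤ C * ((L : ℝ) ^ 2 / B)) ∧
      -- case 2
      (∀ α : Fin N → F, Function.Injective α → (∀ n, α n ≠ 0) → N = 3 * ℓ + 1 →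
        (PRUW.scheme2 α B m ℓ Ku Kd).Achieves PRUW.segCounts
          (3 * r' * (1 + Real.logb (Fintype.card F) P / N) / (1 - 1 / N))
          (3 * r * (1 + Real.logb (Fintype.card F) P) / (1 - 1 / N)) ∧
        (PRUW.scheme2 α B m ℓ Ku Kd).storageSize ≤ C * ((L : ℝ) ^ 2 / (B * (N : ℝ) ^ 2))) ∧
      -- case 3
      (∀ (f : Fin ℓ → F) (α : Fin N → F), Function.Injective f → Function.Injective α →
        (∀ i n, f i ≠ α n) → N = 2 * ℓ + 4 →
        (PRUW.scheme3 f α B m Ku Kd).Achieves PRUW.unorderedCounts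
          (2 * r' * (1 + Real.logb (Fintype.card F) P / N) / (1 - 4 / N))
          (2 * r * (1 + Real.logb (Fintype.card F) P) / (1 - 4 / N)) ∧
        (PRUW.scheme3 f α B m Ku Kd).storageSize ≤
          C * max ((L : ℝ) ^ 2 / B) ((N : ℝ) ^ 2 * (B : ℝ) ^ 2)) ∧
      -- case 4
      (∀ α : Fin N → F, Function.Injective α → (∀ n, α n ≠ 0) → N = 5 * ℓ + 1 →
        (PRUW.scheme4 α B m ℓ Ku Kd).Achieves PRUW.unorderedCounts
          (5 * r' * (1 + Real.logb (Fintype.card F) P / N) / (1 - 1 / N))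
          (5 * r * (1 + Real.logb (Fintype.card F) P) / (1 - 1 / N)) ∧
        (PRUW.scheme4 α B m ℓ Ku Kd).storageSize ≤
          C * max ((L : ℝ) ^ 2 / ((N : ℝ) ^ 2 * B)) ((B : ℝ) ^ 2)) := by
  -- Case 2 uses `2 * 50`; case 4 needs `2 * 36 + 1`, case 3 needs `2 + 1` and case 1 needs 2. The
  -- value 50 is generous, as `(3 * ℓ + 1) ^ 2 ≤ 16 * ℓ ^ 2`.
  refine ⟨100, ?_⟩
  intro F _ _ N P B m ℓ L Ku Kd r r' hB hBP hP hℓ hL hKu hKd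
  subst hP hL
  have hP0 : B * m ≠ 0 := by omega
  have hm : 1 ≤ m := Nat.pos_of_ne_zero (right_ne_zero_of_mul hP0)
  have hℓ0 : ℓ ≠ 0 := by omega
  have hB' : (1 : ℝ) ≤ B := by exact_mod_cast hB
  have hm' : (1 : ℝ) ≤ m := by exact_mod_cast hm
  have hℓ' : (1 : ℝ) ≤ ℓ := by exact_mod_cast hℓ
  -- Answers and uploads have the same types in all four schemes, so one computation with `N = c * ℓ
  -- + a` gives all the costs.
  have hread : ∀ {c a : ℝ}, c ≠ 0 → N ≠ 0 → (N : ℝ) = c * ℓ + a →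
      ((∑ _n : Fin N, PRUW.Scheme.symbols F (Fin Kd → F)) +
        PRUW.Scheme.symbols F (Fin Kd → PRUW.Sub B m)) / ((B * m * ℓ : ℕ) : ℝ) =
      c * r' * (1 + Real.logb (Fintype.card F) ((B * m : ℕ) : ℝ) / N) / (1 - a / N) := by
    intro c a hc hN0 hN
    rw [PRUW.symbols_download, PRUW.readingCost_formula hc hP0 hℓ0 hN0 hN hKd]
  have hwrite : ∀ {c a : ℝ}, c ≠ 0 → N ≠ 0 → (N : ℝ) = c * ℓ + a →
      (∑ _n : Fin N, PRUW.Scheme.symbols F (PRUW.Tuples F B m Ku)) / ((B * m * ℓ : ℕ) : ℝ) =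
      c * r * (1 + Real.logb (Fintype.card F) ((B * m : ℕ) : ℝ)) / (1 - a / N) := by
    intro c a hc hN0 hN
    rw [PRUW.symbols_upload _ _ _ _ hP0, PRUW.writingCost_formula hc hP0 hℓ0 hN0 hN hKu]
  have hunc := PRUW.storage_le_of_uncoded hB' hm' hℓ'
  have hnn : (0 : ℝ) ≤ ((B : ℝ) * m * ℓ) ^ 2 / B := by positivity
  refine ⟨fun f α hf hα hfα hN => ⟨?_, ?_⟩, fun α hα hα0 hN => ⟨?_, ?_⟩,
    fun f α hf hα hfα hN => ⟨?_, ?_⟩, fun α hα hα0 hN => ⟨?_, ?_⟩⟩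
  · have hN' : (N : ℝ) = 2 * ℓ + 2 := by exact_mod_cast hN
    exact PRUW.Scheme.achieves_of_padded (PRUW.scheme1_readCorrect hf hα hfα hN.ge)
      PRUW.scheme1_storePadded (PRUW.scheme1_writePadded hf hfα)
      (PRUW.scheme1_uploadPadded hfα) PRUW.scheme1_keyPadded PRUW.scheme1_uploadReveals
      (hread two_ne_zero (by omega) hN') (hwrite two_ne_zero (by omega) hN')
  · rw [PRUW.scheme1_storageSize]
    push_cast
    linarith
  · have hN' : (N : ℝ) = 3 * ℓ + 1 := by exact_mod_cast hN
    exact PRUW.Scheme.achieves_of_padded (PRUW.scheme2_readCorrect hα hα0 hN.ge)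
      (PRUW.scheme2_storePadded hα0) (PRUW.scheme2_writePadded hα0)
      PRUW.scheme2_uploadPadded PRUW.scheme2_keyPadded PRUW.scheme2_uploadReveals
      (hread three_ne_zero (by omega) hN') (hwrite three_ne_zero (by omega) hN')
  · have hN' : (N : ℝ) = 3 * ℓ + 1 := by exact_mod_cast hN
    have h := PRUW.storage_le_of_coded (c := 50) hB' hm' hℓ'
      (by rw [hN']; nlinarith : (N : ℝ) ^ 2 ≤ 50 * (ℓ : ℝ) ^ 2) (by rw [hN']; positivity)
    rw [PRUW.scheme2_storageSize]
    push_cast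
    linarith
  · have hN' : (N : ℝ) = 2 * ℓ + 4 := by exact_mod_cast hN
    exact PRUW.Scheme.achieves_of_padded (PRUW.scheme3_readCorrect hf hα hfα hN.ge)
      (PRUW.scheme3_storePadded hfα) (PRUW.scheme3_writePadded hf hfα)
      (PRUW.scheme3_uploadPadded hfα) PRUW.scheme3_keyPadded PRUW.scheme3_uploadReveals
      (hread two_ne_zero (by omega) hN') (hwrite two_ne_zero (by omega) hN')
  · have hN' : (N : ℝ) = 2 * ℓ + 4 := by exact_mod_cast hN
    have h : ((B : ℝ) * ℓ) ^ 2 ≤ (N : ℝ) ^ 2 * (B : ℝ) ^ 2 := by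
      rw [mul_comm (B : ℝ), mul_pow]
      gcongr
      linarith
    rw [PRUW.scheme3_storageSize]
    push_cast
    have h1 := le_max_left (((B : ℝ) * m * ℓ) ^ 2 / B) ((N : ℝ) ^ 2 * (B : ℝ) ^ 2)
    have h2 := le_max_right (((B : ℝ) * m * ℓ) ^ 2 / B) ((N : ℝ) ^ 2 * (B : ℝ) ^ 2)
    linarith
  · have hN' : (N : ℝ) = 5 * ℓ + 1 := by exact_mod_cast hN
    exact PRUW.Scheme.achieves_of_padded (PRUW.scheme4_readCorrect hα hα0 hN.ge)
      (PRUW.scheme4_storePadded hα0) (PRUW.scheme4_writePadded hα0)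
      PRUW.scheme4_uploadPadded PRUW.scheme4_keyPadded PRUW.scheme4_uploadReveals
      (hread (by norm_num) (by omega) hN') (hwrite (by norm_num) (by omega) hN')
  · have hN' : (N : ℝ) = 5 * ℓ + 1 := by exact_mod_cast hN
    have h := PRUW.storage_le_of_coded (c := 36) hB' hm' hℓ'
      (by rw [hN']; nlinarith : (N : ℝ) ^ 2 ≤ 36 * (ℓ : ℝ) ^ 2) (by rw [hN']; positivity)
    rw [mul_comm (B : ℝ) ((N : ℝ) ^ 2)] at h
    rw [PRUW.scheme4_storageSize]
    push_cast
    have h1 := le_max_left (((B : ℝ) * m * ℓ) ^ 2 / ((N : ℝ) ^ 2 * B)) ((B : ℝ) ^ 2)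
    have h2 := le_max_right (((B : ℝ) * m * ℓ) ^ 2 / ((N : ℝ) ^ 2 * B)) ((B : ℝ) ^ 2)
    have h3 : (0 : ℝ) ≤ (B : ℝ) ^ 2 := by positivity
    linarith
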